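/- For a Borel probability measure $\mu$ on $\mathbb{R}$ let $\widehat\mu(\xi)=\int e^{-2\pi i\xi x}\,d\mu(x)$ and let $$\kappa_2(\mu)=\sup\Big\{0\le s<1:\ \exists C\ \forall R>0,\ \int_{-R}^{R}|\widehat\mu(\xi)|^2\,d\xi\le C R^{1-s}\Big\}$$ be its Fourier $l^2$ dimension (lower correlation dimension). A self-similar measure on $\mathbb{R}$ is the unique Borel probability measure $\mu$ with $\mu=\sum_{i=1}^N p_i\,(f_i)_*\mu$, where $N\ge 2$, $p_i\in(0,1)$, $\sum_i p_i=1$, $f_i(x)=\pm r_i x+t_i$ with $r_i\in(0,1)$, $t_i\in\mathbb{R}$, and the $f_i$ have no common fixed point; no separation condition is assumed. A measure $\nu$ is AD-regular if there are $s\ge0$ and $C\ge1$ such that $C^{-1}r^s\le\nu(B_r(x))\le Cr^s$ for all $x\in\operatorname{supp}\nu$ and $0<r\le1$. Write $\mu\cdot\nu$ for the multiplicative convolution, that is, the push-forward of $\mu\times\nu$ under $(x,y)\mapsto xy$. Proposition. Let $\mu$ and $\nu$ be self-similar measures on $\mathbb{R}$ whose supports are contained in $(0,\infty)$. Suppose that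 at least one of the following holds: 1. $\min\{\kappa_2(\mu),\kappa_2(\nu)\}>7/9$; 2. $\max\{4\kappa_2(\mu)+5\kappa_2(\nu),\,5\kappa_2(\mu)+4\kappa_2(\nu)\}>7$; 3. $\nu$ is AD-regular and $2\kappa_2(\mu)\kappa_2(\nu)+3\kappa_2(\mu)+2\kappa_2(\nu)>5$. Then $\mu\cdot\nu$ is absolutely continuous with respect to Lebesgue measure on $\mathbb{R}$, with a density in $L^2(\mathbb{R})$. -/

import Mathlib

open MeasureTheory

noncomputable section

/-- The Fourier transform of a measure on the real line,
with the normalisation `∫ exp (-2 π i ξ x) dμ(x)`. -/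
def fourierTransform (μ : Measure ℝ) (ξ : ℝ) : ℂ :=
  ∫ x, Complex.exp (-2 * Real.pi * Complex.I * ξ * x) ∂μ

/-- The Fourier `l²` dimension `κ₂` of a Borel probability measure on the real line: the supremum
of the `s ∈ [0, 1)` such that the integral of `|μ̂|²` over `(-R, R)` is at most a constant
(depending on `s` and `μ` only) times `R ^ (1 - s)`. The set contains `0` and is bounded by `1`. -/
def kappaTwo (μ : Measure ℝ) : ℝ :=
  sSup {s : ℝ | 0 ≤ s ∧ s < 1 ∧ ∃ C : ℝ, ∀ R : ℝ, 0 < R →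
    ∫ ξ in Metric.ball (0 : ℝ) R, ‖fourierTransform μ ξ‖ ^ 2 ≤ C * R ^ (1 - s)}

/-- A finite system of contracting similarities `x ↦ r i * O i * x + t i` of the real line, with
`r i ∈ (0, 1)` and orthogonal part `O i = ± 1`, having at least two maps and no fixed point common
to all of them. -/
structure SimilarityIFS (N : ℕ) where
  /-- contraction ratios -/
  r : Fin N → ℝ
  /-- orthogonal parts -/
  O : Fin N → ℝ
  /-- translation parts -/
  t : Fin N → ℝ
  two_le : 2 ≤ N
  r_pos : ∀ i, 0 < r i
  r_lt_one : ∀ i, r i < 1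
  O_eq : ∀ i, O i = 1 ∨ O i = -1
  no_common_fixed_point : ¬ ∃ x : ℝ, ∀ i, r i * O i * x + t i = x

/-- The `i`-th similarity of the system. -/
def SimilarityIFS.toFun {N : ℕ} (Λ : SimilarityIFS N) (i : Fin N) (x : ℝ) : ℝ :=
  Λ.r i * Λ.O i * x + Λ.t i

/-- `K` is the attractor of the system: the non-empty compact set that is the union of its
images. -/
structure SimilarityIFS.IsAttractor {N : ℕ} (Λ : SimilarityIFS N) (K : Set ℝ) : Prop where
  nonempty : K.Nonempty
  isCompact : IsCompact K
  eq_iUnion : K = ⋃ i, Λ.toFun i '' K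

/-- `μ` is a self-similar measure: the Borel probability measure on the attractor of some system of
similarities that satisfies `μ = ∑ i, p i • (f i)_* μ` for some probability weights
`p i ∈ (0, 1)`. -/
def IsSelfSimilarMeasure (μ : Measure ℝ) : Prop :=
  IsProbabilityMeasure μ ∧
  ∃ (N : ℕ) (Λ : SimilarityIFS N) (p : Fin N → ℝ) (K : Set ℝ),
    (∀ i, 0 < p i ∧ p i < 1) ∧ ∑ i, p i = 1 ∧
    Λ.IsAttractor K ∧ μ Kᶜ = 0 ∧
    μ = ∑ i, ENNReal.ofReal (p i) • μ.map (Λ.toFun i)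

/-- Ahlfors-David regularity of a finite measure of bounded support. The radii are bounded by `1`,
since the lower bound cannot hold for arbitrarily large balls if `s > 0`. -/
def IsADRegular (μ : Measure ℝ) : Prop :=
  ∃ s C : ℝ, 0 ≤ s ∧ 1 ≤ C ∧ ∀ x ∈ μ.support, ∀ r : ℝ, 0 < r → r ≤ 1 →
    C⁻¹ * r ^ s ≤ μ.real (Metric.ball x r) ∧ μ.real (Metric.ball x r) ≤ C * r ^ s

/-- The measure `μ` is absolutely continuous with respect to Lebesgue measure, with a density in
`L²`. -/
def HasL2Density (μ : Measure ℝ) : Prop :=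
  ∃ g : ℝ → ℝ, (∀ x, 0 ≤ g x) ∧ MemLp g 2 volume ∧
    μ = volume.withDensity (fun x => ENNReal.ofReal (g x))

end

noncomputable section

open scoped ENNReal NNReal Topology

/-! The logarithm turns multiplicative into additive convolution, so the Fourier transform of the
log image of `μ·ν` is the product of those of `log μ` and `log ν`. By Plancherel it suffices that
this product is square integrable; `hasL2Density_of_map_log` carries the density back.

Square integrability follows from pointwise decay `|ξ|^(-τ)` of one factor and energy decay
`R^(-s')` of the other, provided `2τ + s' > 1`. The second is inherited from `ν`, because energies
are stable under bi-Lipschitz maps and `log` is one on a compact subset of `(0, ∞)`.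

Pointwise decay of `log μ` comes from curvature (`exists_fourierTransform_map_log_le`). Cut `μ` into
cylinders of ratio about `δ`. On each, `log` is affine up to `O(δ²)`, so its contribution is `|μ̂|`
at frequency about `ξδ/y`, with `y` in the cylinder, up to `O(ξδ²)`. Summing over cylinders averages
over `y` with respect to `μ`, and `exists_lintegral_fourierTransform_div_le` bounds this average by
`(ξδ)^(1/2-s)` for `s < κ₂(μ)`. The two errors balance at decay exponent `σ = (2s-1)/(3+2s)`, up to
an arbitrarily small loss. Then `2σ + s' > 1` is, in the limit, `2κ₂(μ)κ₂(ν) + 2κ₂(μ) + 3κ₂(ν) > 5`;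
each listed condition implies this or its mirror image. -/

/-! ### Fourier transforms of measures and Gaussian energies -/

lemma norm_fourier_kernel (ξ x : ℝ) :
    ‖Complex.exp (-2 * Real.pi * Complex.I * ξ * x)‖ = 1 := by
  rw [show (-2 * Real.pi * Complex.I * ξ * x : ℂ) = ((-2 * Real.pi * ξ * x : ℝ) : ℂ) * Complex.I by
    push_cast; ring]
  exact Complex.norm_exp_ofReal_mul_I _

lemma continuous_fourierTransform (μ : Measure ℝ) [IsFiniteMeasure μ] :
    Continuous (fourierTransform μ) := by
  refine continuous_of_dominated (bound := fun _ => 1) (fun ξ => by fun_prop)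
    (fun ξ => .of_forall fun x => (norm_fourier_kernel ξ x).le) (integrable_const _)
    (.of_forall fun x => by fun_prop)

lemma norm_fourierTransform_le_one (μ : Measure ℝ) [IsProbabilityMeasure μ] (ξ : ℝ) :
    ‖fourierTransform μ ξ‖ ≤ 1 := by
  refine (norm_integral_le_of_norm_le_const
    (.of_forall fun x => (norm_fourier_kernel ξ x).le)).trans ?_
  simp

lemma star_fourierTransform (μ : Measure ℝ) (ξ : ℝ) :
    (starRingEnd ℂ) (fourierTransform μ ξ) = fourierTransform μ (-ξ) := by
  unfold fourierTransform
  rw [← integral_conj]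
  congr 1
  ext x
  rw [← Complex.exp_conj]
  congr 1
  simp only [map_mul, map_neg, Complex.conj_I, Complex.conj_ofReal, map_ofNat]
  push_cast
  ring

lemma norm_fourierTransform_neg (μ : Measure ℝ) (ξ : ℝ) :
    ‖fourierTransform μ (-ξ)‖ = ‖fourierTransform μ ξ‖ := by
  rw [← star_fourierTransform, RCLike.norm_conj]

/-- The Gaussian energy of a measure at frequency scale `R`. -/
def gaussEnergy (μ : Measure ℝ) (R : ℝ) : ℝ≥0∞ :=
  ∫⁻ x, ∫⁻ y, ENNReal.ofReal (Real.exp (-Real.pi * R ^ 2 * (x - y) ^ 2)) ∂μ ∂μ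

lemma fourier_gaussian_scaled {R : ℝ} (hR : 0 < R) (t : ℝ) :
    ∫ ξ : ℝ, Complex.exp (-2 * Real.pi * Complex.I * ξ * t) *
      (Real.exp (-Real.pi * ξ ^ 2 / R ^ 2) : ℂ) =
      ((R * Real.exp (-Real.pi * R ^ 2 * t ^ 2) : ℝ) : ℂ) := by
  have hb : ((-Real.pi / R ^ 2 : ℝ) : ℂ).re < 0 := by
    rw [Complex.ofReal_re]
    have := Real.pi_pos
    rw [neg_div]
    exact neg_neg_of_pos (by positivity)
  have h := integral_cexp_quadratic hb (-2 * Real.pi * Complex.I * t) 0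
  have hR' : (R : ℂ) ≠ 0 := by exact_mod_cast hR.ne'
  have hpi : (Real.pi : ℂ) ≠ 0 := by exact_mod_cast Real.pi_ne_zero
  have e1 : (Real.pi / -((-Real.pi / R ^ 2 : ℝ) : ℂ)) ^ (1 / 2 : ℂ) = (R : ℂ) := by
    rw [show (Real.pi / -((-Real.pi / R ^ 2 : ℝ) : ℂ)) = ((R ^ 2 : ℝ) : ℂ) by
      push_cast; field_simp]
    rw [show (1 / 2 : ℂ) = ((1 / 2 : ℝ) : ℂ) by push_cast; rfl,
      ← Complex.ofReal_cpow (by positivity), ← Real.sqrt_eq_rpow, Real.sqrt_sq hR.le]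
  rw [e1] at h
  rw [Complex.ofReal_mul, Complex.ofReal_exp]
  convert h using 2
  · ext ξ
    rw [Complex.ofReal_exp, ← Complex.exp_add]
    congr 1
    push_cast
    ring
  · congr 1
    push_cast
    field_simp
    ring_nf
    simp

lemma integrable_gaussian_scaled {R : ℝ} (hR : 0 < R) :
    Integrable (fun ξ : ℝ => Real.exp (-Real.pi * ξ ^ 2 / R ^ 2)) := by
  have := integrable_exp_neg_mul_sq (b := Real.pi / R ^ 2) (by have := Real.pi_pos; positivity)
  refine this.congr (.of_forall fun x => ?_)
  simp only
  congr 1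
  ring

lemma normSq_fourierTransform (μ : Measure ℝ) [IsFiniteMeasure μ] (ξ : ℝ) :
    ((‖fourierTransform μ ξ‖ ^ 2 : ℝ) : ℂ) =
      ∫ z : ℝ × ℝ, Complex.exp (-2 * Real.pi * Complex.I * ξ * ((z.1 - z.2 : ℝ) : ℂ))
        ∂(μ.prod μ) := by
  have : ((‖fourierTransform μ ξ‖ ^ 2 : ℝ) : ℂ) =
      fourierTransform μ ξ * fourierTransform μ (-ξ) := by
    rw [← star_fourierTransform, Complex.mul_conj, Complex.normSq_eq_norm_sq]
  rw [this]
  unfold fourierTransform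
  rw [← integral_prod_mul]
  congr 1
  ext z
  rw [← Complex.exp_add]
  congr 1
  push_cast
  ring

lemma integrable_normSq_fourierTransform_mul_gaussian (μ : Measure ℝ) [IsFiniteMeasure μ]
    {R : ℝ} (hR : 0 < R) :
    Integrable (fun ξ : ℝ => ‖fourierTransform μ ξ‖ ^ 2 *
      Real.exp (-Real.pi * ξ ^ 2 / R ^ 2)) := by
  refine (integrable_gaussian_scaled hR).bdd_mul (c := (μ.real Set.univ) ^ 2)
    ((continuous_fourierTransform μ).norm.pow 2).aestronglyMeasurable (.of_forall fun ξ => ?_)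
  rw [norm_pow, norm_norm]
  gcongr
  refine (norm_integral_le_of_norm_le_const
    (.of_forall fun x => (norm_fourier_kernel ξ x).le)).trans ?_
  simp

/-- Fubini and the Gaussian's own Fourier transform. This identity replaces quadratic Fourier
averages by energies, which, unlike Fourier transforms, are monotone in the measure and behave well
under Lipschitz changes of variable. -/
lemma lintegral_normSq_fourierTransform_mul_gaussian (μ : Measure ℝ) [IsFiniteMeasure μ]
    {R : ℝ} (hR : 0 < R) :
    ∫⁻ ξ : ℝ, ‖fourierTransform μ ξ‖ₑ ^ 2 *
      ENNReal.ofReal (Real.exp (-Real.pi * ξ ^ 2 / R ^ 2)) =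
      ENNReal.ofReal R * gaussEnergy μ R := by
  have key : ∫ ξ : ℝ, ‖fourierTransform μ ξ‖ ^ 2 * Real.exp (-Real.pi * ξ ^ 2 / R ^ 2) =
      ∫ z : ℝ × ℝ, R * Real.exp (-Real.pi * R ^ 2 * (z.1 - z.2) ^ 2) ∂(μ.prod μ) := by
    rw [← Complex.ofReal_inj, ← integral_complex_ofReal, ← integral_complex_ofReal]
    simp_rw [← fourier_gaussian_scaled hR]
    rw [integral_integral_swap]
    · congr 1
      ext ξ
      rw [integral_mul_const, ← normSq_fourierTransform]
      push_cast
      rfl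
    · have h1 : Integrable (fun w : (ℝ × ℝ) × ℝ => Real.exp (-Real.pi * w.2 ^ 2 / R ^ 2))
          ((μ.prod μ).prod volume) := (integrable_gaussian_scaled hR).comp_snd _
      refine h1.mono' (Continuous.aestronglyMeasurable
        (by simp only [Function.uncurry_def]; fun_prop)) (.of_forall fun w => ?_)
      simp only [Function.uncurry]
      rw [norm_mul, norm_fourier_kernel, one_mul, Complex.norm_real, Real.norm_eq_abs,
        abs_of_pos (Real.exp_pos _)]
  have h2 : ∫⁻ ξ : ℝ, ‖fourierTransform μ ξ‖ₑ ^ 2 *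
      ENNReal.ofReal (Real.exp (-Real.pi * ξ ^ 2 / R ^ 2)) =
      ENNReal.ofReal (∫ ξ : ℝ, ‖fourierTransform μ ξ‖ ^ 2 *
        Real.exp (-Real.pi * ξ ^ 2 / R ^ 2)) := by
    rw [ofReal_integral_eq_lintegral_ofReal
      (integrable_normSq_fourierTransform_mul_gaussian μ hR)
      (.of_forall fun ξ => by positivity)]
    congr 1
    ext ξ
    rw [ENNReal.ofReal_mul (by positivity), ENNReal.ofReal_pow (norm_nonneg _), ofReal_norm]
  rw [h2, key, ofReal_integral_eq_lintegral_ofReal _ (.of_forall fun ξ => by positivity)]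
  · rw [lintegral_prod _ (by fun_prop)]
    unfold gaussEnergy
    simp_rw [ENNReal.ofReal_mul hR.le]
    rw [← lintegral_const_mul _ (by fun_prop)]
    congr 1
    ext x
    rw [← lintegral_const_mul _ (by fun_prop)]
  · refine Integrable.const_mul (Integrable.of_bound (by fun_prop) 1 (.of_forall fun z => ?_)) R
    rw [Real.norm_eq_abs, abs_of_pos (Real.exp_pos _), Real.exp_le_one_iff]
    have := Real.pi_pos
    have : 0 ≤ Real.pi * R ^ 2 * (z.1 - z.2) ^ 2 := by positivity
    linarith

/-- The Gaussian decreases with distance, so a map that expands distances by at least `c` can only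
lower the energy, up to rescaling `R`. -/
lemma gaussEnergy_map_le {μ : Measure ℝ} {f : ℝ → ℝ} (hf : Measurable f) {c : ℝ} (hc : 0 ≤ c)
    {A : Set ℝ} (hA : ∀ᵐ x ∂μ, x ∈ A)
    (h : ∀ x ∈ A, ∀ y ∈ A, c * |x - y| ≤ |f x - f y|) [SFinite μ] (R : ℝ) :
    gaussEnergy (μ.map f) R ≤ gaussEnergy μ (c * R) := by
  unfold gaussEnergy
  rw [lintegral_map _ hf]
  swap
  · apply Measurable.lintegral_prod_right'
      (f := fun z : ℝ × ℝ => ENNReal.ofReal (Real.exp (-Real.pi * R ^ 2 * (z.1 - z.2) ^ 2)))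
    fun_prop
  refine lintegral_mono_ae ?_
  filter_upwards [hA] with x hx
  rw [lintegral_map (by fun_prop) hf]
  refine lintegral_mono_ae ?_
  filter_upwards [hA] with y hy
  refine ENNReal.ofReal_le_ofReal (Real.exp_le_exp.2 ?_)
  have h1 : (c * |x - y|) ^ 2 ≤ |f x - f y| ^ 2 := by
    have := h x hx y hy
    gcongr
  rw [mul_pow, sq_abs, sq_abs] at h1
  have h2 := mul_le_mul_of_nonneg_left h1 (show 0 ≤ Real.pi * R ^ 2 by positivity)
  nlinarith

lemma gaussEnergy_mono {μ ν : Measure ℝ} (h : μ ≤ ν) (R : ℝ) :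
    gaussEnergy μ R ≤ gaussEnergy ν R := by
  unfold gaussEnergy
  exact lintegral_mono' h fun x => lintegral_mono' h le_rfl

lemma gaussEnergy_smul {c : ℝ≥0∞} (hc : c ≠ ⊤) (μ : Measure ℝ) (R : ℝ) :
    gaussEnergy (c • μ) R = c ^ 2 * gaussEnergy μ R := by
  unfold gaussEnergy
  simp only [lintegral_smul_measure, smul_eq_mul]
  rw [lintegral_const_mul' _ _ hc, pow_two c, mul_assoc]

/-! ### Plancherel: square integrable transforms give densities -/

open scoped SchwartzMap FourierTransform in
lemma exists_L2_density_of_lintegral_normSq_fourierTransform (μ : Measure ℝ) [IsFiniteMeasure μ]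
    (h : ∫⁻ ξ, ‖fourierTransform μ ξ‖ₑ ^ 2 < ∞) :
    ∃ g : ℝ → ℂ, MemLp g 2 volume ∧
      ∀ ψ : 𝓢(ℝ, ℂ), ∫ x, ψ x ∂μ = ∫ x, ψ x * g x := by
  have hm : MemLp (fourierTransform μ) 2 volume := by
    refine ⟨(continuous_fourierTransform μ).aestronglyMeasurable, ?_⟩
    rw [eLpNorm_lt_top_iff_lintegral_rpow_enorm_lt_top (by norm_num) (by norm_num)]
    simpa using h
  refine ⟨(𝓕⁻ (hm.toLp (fourierTransform μ)) : Lp ℂ 2 (volume : Measure ℝ)), Lp.memLp _, fun ψ => ?_⟩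
  have h1 := congrArg (fun T => T ψ)
    (Lp.fourierInv_toTemperedDistribution_eq (hm.toLp (fourierTransform μ)))
  simp only [TemperedDistribution.fourierInv_apply, Lp.toTemperedDistribution_apply,
    smul_eq_mul] at h1
  rw [← h1]
  have h2 : ∫ x, (𝓕⁻ ψ) x * hm.toLp (fourierTransform μ) x = ∫ ξ : ℝ, ∫ x : ℝ, (𝓕⁻ ψ) ξ *
      Complex.exp (-2 * Real.pi * Complex.I * ξ * x) ∂μ := by
    refine integral_congr_ae ?_
    filter_upwards [hm.coeFn_toLp] with ξ hξ
    rw [hξ, fourierTransform, integral_const_mul]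
  rw [h2, integral_integral_swap]
  · congr 1
    ext x
    have h3 : 𝓕 (𝓕⁻ ψ) x = ψ x := by simp
    rw [← h3, SchwartzMap.fourier_coe, Real.fourier_eq']
    congr 1
    ext ξ
    rw [smul_eq_mul, mul_comm]
    congr 2
    simp
    ring
  · have h1 : Integrable (fun w : ℝ × ℝ => (𝓕⁻ ψ) w.1) (volume.prod μ) :=
      (𝓕⁻ ψ).integrable.comp_fst _
    refine h1.mono (Continuous.aestronglyMeasurable ?_) (.of_forall fun w => ?_)
    · have := (𝓕⁻ ψ).continuous
      simp only [Function.uncurry_def]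
      fun_prop
    · simp only [Function.uncurry]
      rw [norm_mul, norm_fourier_kernel, mul_one]

/-- The inverse transform of `μ̂` agrees with `μ` against Schwartz functions, hence on balls. It is
complex valued a priori, so positivity has to be recovered from that of `μ`. -/
lemma hasL2Density_of_lintegral_normSq_fourierTransform (μ : Measure ℝ) [IsFiniteMeasure μ]
    (h : ∫⁻ ξ, ‖fourierTransform μ ξ‖ₑ ^ 2 < ∞) : HasL2Density μ := by
  obtain ⟨g, hg, hgψ⟩ := exists_L2_density_of_lintegral_normSq_fourierTransform μ h
  set G : ℝ → ℝ := fun x => (g x).re with hG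
  have hGm : MemLp G 2 volume := hg.re
  have hloc : LocallyIntegrable G := hGm.locallyIntegrable (by norm_num)
  have hball : ∀ c r : ℝ, 0 < r → μ.real (Metric.ball c r) = ∫ x in Metric.ball c r, G x := by
    intro c r hr
    -- The inner radii increase to `r`, so the bumps converge pointwise to the indicator of the open
    -- ball.
    let b : ℕ → ContDiffBump c := fun n =>
      ⟨r * (n + 1) / (n + 2), r, by positivity, by
        rw [div_lt_iff₀ (by positivity)]; nlinarith⟩
    have hb0 : ∀ n x, x ∉ Metric.ball c r → b n x = 0 := fun n x hx => by
      refine (b n).zero_of_le_dist ?_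
      simpa [Metric.mem_ball, b] using hx
    have hlim : ∀ x, Filter.Tendsto (fun n => b n x) Filter.atTop
        (𝓝 ((Metric.ball c r).indicator 1 x)) := by
      intro x
      by_cases hx : x ∈ Metric.ball c r
      · rw [Set.indicator_of_mem hx]
        have h1 : Filter.Tendsto (fun n : ℕ => r * ((n : ℝ) + 1) / (n + 2)) Filter.atTop (𝓝 r) := by
          have : Filter.Tendsto (fun n : ℕ => r - r * (1 / (((n + 1 : ℕ) : ℝ) + 1)))
              Filter.atTop (𝓝 (r - r * 0)) :=
            tendsto_const_nhds.sub
              (((Filter.tendsto_add_atTop_iff_nat 1).2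
                tendsto_one_div_add_atTop_nhds_zero_nat).const_mul r)
          rw [mul_zero, sub_zero] at this
          refine this.congr fun n => ?_
          have : (n : ℝ) + 2 ≠ 0 := by positivity
          have : (n : ℝ) + 1 + 1 ≠ 0 := by positivity
          push_cast
          field_simp
          ring
        refine tendsto_const_nhds.congr' ?_
        filter_upwards [h1.eventually (lt_mem_nhds (Metric.mem_ball.1 hx))] with n hn
        exact ((b n).one_of_mem_closedBall (Metric.mem_closedBall.2 hn.le)).symm
      · rw [Set.indicator_of_notMem hx]
        simp [hb0 _ x hx]
    have hbd : ∀ n x, ‖b n x‖ ≤ (Metric.ball c r).indicator 1 x := by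
      intro n x
      by_cases hx : x ∈ Metric.ball c r
      · rw [Set.indicator_of_mem hx, Real.norm_eq_abs, abs_of_nonneg (b n).nonneg]
        exact (b n).le_one
      · rw [hb0 n x hx, Set.indicator_of_notMem hx, norm_zero]
    have heq : ∀ n, ∫ x, b n x ∂μ = ∫ x, b n x * G x := by
      intro n
      let ψ : SchwartzMap ℝ ℂ := HasCompactSupport.toSchwartzMap (f := fun x => (b n x : ℂ))
        ((b n).hasCompactSupport.comp_left (g := fun t : ℝ => (t : ℂ)) (by simp))
        (Complex.ofRealCLM.contDiff.comp (b n).contDiff)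
      have h1 := congrArg Complex.re (hgψ ψ)
      have e1 : ∀ x, ψ x = (b n x : ℂ) := fun x => rfl
      simp only [e1] at h1
      rw [integral_complex_ofReal, Complex.ofReal_re] at h1
      rw [h1, ← RCLike.re_eq_complex_re, ← integral_re]
      · congr 1
        ext x
        simp [hG]
      · have h3 : MemLp (fun x => (b n x : ℂ)) 2 volume := by
          have := ψ.memLp 2 volume
          exact this
        exact h3.integrable_mul hg
    have l1 : Filter.Tendsto (fun n => ∫ x, b n x ∂μ) Filter.atTop (𝓝 (μ.real (Metric.ball c r))) := by
      rw [← integral_indicator_one measurableSet_ball]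
      refine tendsto_integral_of_dominated_convergence ((Metric.ball c r).indicator 1)
        (fun n => (b n).continuous.aestronglyMeasurable)
        ((integrable_const (1 : ℝ)).indicator measurableSet_ball)
        (fun n => .of_forall (hbd n)) (.of_forall hlim)
    have l2 : Filter.Tendsto (fun n => ∫ x, b n x * G x) Filter.atTop
        (𝓝 (∫ x in Metric.ball c r, G x)) := by
      rw [← integral_indicator measurableSet_ball]
      refine tendsto_integral_of_dominated_convergence
        (fun x => (Metric.ball c r).indicator (fun x => |G x|) x)
        (fun n => (b n).continuous.aestronglyMeasurable.mul hGm.1) ?_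
        (fun n => .of_forall fun x => ?_) (.of_forall fun x => ?_)
      · rw [integrable_indicator_iff measurableSet_ball]
        exact ((hloc.integrableOn_isCompact (isCompact_closedBall c r)).mono_set
          Metric.ball_subset_closedBall).abs
      · rw [norm_mul]
        refine (mul_le_mul_of_nonneg_right (hbd n x) (norm_nonneg _)).trans ?_
        by_cases hx : x ∈ Metric.ball c r <;> simp [hx]
      · convert (hlim x).mul_const (G x) using 2
        by_cases hx : x ∈ Metric.ball c r <;> simp [hx]
    simp only [heq] at l1
    exact tendsto_nhds_unique l1 l2
  set P := volume.withDensity (fun x => ENNReal.ofReal (G x)) with hP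
  set Q := volume.withDensity (fun x => ENNReal.ofReal (-G x)) with hQ
  have hfin : ∀ F : ℝ → ℝ, LocallyIntegrable F → ∀ c r : ℝ,
      volume.withDensity (fun x => ENNReal.ofReal (F x)) (Metric.ball c r) < ∞ := by
    intro F hF c r
    rw [withDensity_apply _ measurableSet_ball]
    exact Integrable.lintegral_lt_top ((hF.integrableOn_isCompact
      (isCompact_closedBall c r)).mono_set Metric.ball_subset_closedBall)
  have hfin' : ∀ F : ℝ → ℝ, LocallyIntegrable F →
      IsLocallyFiniteMeasure (volume.withDensity (fun x => ENNReal.ofReal (F x))) :=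
    fun F hF => ⟨fun x => ⟨Metric.ball x 1, Metric.ball_mem_nhds x one_pos, hfin F hF x 1⟩⟩
  have := hfin' _ hloc
  have := hfin' _ hloc.neg
  -- The negative part is moved to the left so that all measures are positive; agreement on
  -- intervals then suffices, and `μ ≤ P` gives absolute continuity and the bound on the density.
  have hPQ : μ + Q = P := by
    have : IsLocallyFiniteMeasure (μ + Q) := by
      refine ⟨fun x => ⟨Metric.ball x 1, Metric.ball_mem_nhds x one_pos, ?_⟩⟩
      rw [Measure.add_apply]
      exact ENNReal.add_lt_top.2 ⟨measure_lt_top _ _, hfin _ hloc.neg x 1⟩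
    refine Real.measure_ext_Ioo_rat fun a b => ?_
    rcases le_or_gt (b : ℝ) a with hab | hab
    · simp [Set.Ioo_eq_empty (not_lt.2 hab)]
    · rw [Real.Ioo_eq_ball]
      set c : ℝ := (a + b) / 2
      set r : ℝ := (b - a) / 2
      have hr : 0 < r := by simp only [r]; linarith
      have hI : IntegrableOn G (Metric.ball c r) := (hloc.integrableOn_isCompact
        (isCompact_closedBall c r)).mono_set Metric.ball_subset_closedBall
      have e := hball c r hr
      rw [integral_eq_lintegral_pos_part_sub_lintegral_neg_part hI,
        ← withDensity_apply _ measurableSet_ball, ← withDensity_apply _ measurableSet_ball] at e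
      have f1 := (hfin _ hloc c r).ne
      have f2 : Q (Metric.ball c r) ≠ ∞ := (hfin _ hloc.neg c r).ne
      rw [Measure.add_apply, ← ENNReal.toReal_eq_toReal_iff' (by finiteness) f1,
        ENNReal.toReal_add (by finiteness) f2]
      change (μ _).toReal = (P _).toReal - (Q _).toReal at e
      rw [e]
      ring
  have hle : μ ≤ P := hPQ ▸ Measure.le_add_right le_rfl
  have hac : μ ≪ volume :=
    (Measure.absolutelyContinuous_of_le hle).trans (withDensity_absolutelyContinuous _ _)
  have hrn : μ.rnDeriv volume ≤ᵐ[volume] fun x => ENNReal.ofReal (G x) := by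
    refine ae_le_of_forall_setLIntegral_le_of_sigmaFinite (μ.measurable_rnDeriv volume)
      fun s hs _ => ?_
    rw [Measure.setLIntegral_rnDeriv hac, ← withDensity_apply _ hs]
    exact hle s
  refine ⟨fun x => (μ.rnDeriv volume x).toReal, fun x => ENNReal.toReal_nonneg, ?_, ?_⟩
  · refine hGm.mono (μ.measurable_rnDeriv volume).ennreal_toReal.aestronglyMeasurable ?_
    filter_upwards [hrn] with x hx
    rw [Real.norm_eq_abs, abs_of_nonneg ENNReal.toReal_nonneg]
    refine (ENNReal.toReal_mono ENNReal.ofReal_ne_top hx).trans ?_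
    rw [ENNReal.toReal_ofReal']
    exact max_le (Real.le_norm_self _) (norm_nonneg _)
  · conv_lhs => rw [← Measure.withDensity_rnDeriv_eq μ volume hac]
    refine withDensity_congr_ae ?_
    filter_upwards [Measure.rnDeriv_lt_top μ volume] with x hx
    rw [ENNReal.ofReal_toReal hx.ne]

/-! ### Energy decay from Fourier averages -/

/-- A bound on the quadratic Fourier averages gives a power decay of the Gaussian energy. -/
lemma exists_gaussEnergy_le_of_integral_le (μ : Measure ℝ) [IsFiniteMeasure μ] {s C : ℝ}
    (hs0 : 0 ≤ s) (h : ∀ R : ℝ, 0 < R →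
      ∫ ξ in Metric.ball (0 : ℝ) R, ‖fourierTransform μ ξ‖ ^ 2 ≤ C * R ^ (1 - s)) :
    ∃ D : ℝ, 0 < D ∧ ∀ R : ℝ, 0 < R → gaussEnergy μ R ≤ ENNReal.ofReal (D * R ^ (-s)) := by
  have hsum : Summable fun n : ℕ => Real.exp (-n) * ((n : ℝ) + 1) := by
    have h1 := Real.summable_pow_mul_exp_neg_nat_mul 1 one_pos
    have h2 := Real.summable_pow_mul_exp_neg_nat_mul 0 one_pos
    refine (h1.add h2).congr fun n => ?_
    simp
    ring
  set S : ℝ := ∑' n : ℕ, Real.exp (-n) * ((n : ℝ) + 1) with hS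
  have hS0 : 0 ≤ S := tsum_nonneg fun n => by positivity
  refine ⟨S * |C| + 1, by positivity, fun R hR => ?_⟩
  have hball : ∀ r : ℝ, 0 < r → ∫⁻ ξ in Metric.ball (0 : ℝ) r, ‖fourierTransform μ ξ‖ₑ ^ 2 ≤
      ENNReal.ofReal (|C| * r ^ (1 - s)) := by
    intro r hr
    have hI : IntegrableOn (fun ξ => ‖fourierTransform μ ξ‖ ^ 2) (Metric.ball (0 : ℝ) r) :=
      (((continuous_fourierTransform μ).norm.pow 2).continuousOn.integrableOn_compact
        (isCompact_closedBall 0 r)).mono_set Metric.ball_subset_closedBall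
    have e : ∫⁻ ξ in Metric.ball (0 : ℝ) r, ‖fourierTransform μ ξ‖ₑ ^ 2 =
        ENNReal.ofReal (∫ ξ in Metric.ball (0 : ℝ) r, ‖fourierTransform μ ξ‖ ^ 2) := by
      rw [ofReal_integral_eq_lintegral_ofReal hI (.of_forall fun ξ => by positivity)]
      congr 1
      ext ξ
      rw [ENNReal.ofReal_pow (norm_nonneg _), ofReal_norm]
    rw [e]
    refine ENNReal.ofReal_le_ofReal ((h r hr).trans ?_)
    gcongr
    exact le_abs_self C
  -- A Gaussian is dominated by a sum of ball indicators with weights `exp (-n)`, whose decay beats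
  -- the growth of the averages with the radius.
  have hpt : ∀ ξ : ℝ, ENNReal.ofReal (Real.exp (-Real.pi * ξ ^ 2 / R ^ 2)) ≤
      ∑' n : ℕ, (Metric.ball (0 : ℝ) (R * (n + 1))).indicator
        (fun _ => ENNReal.ofReal (Real.exp (-n))) ξ := by
    intro ξ
    set n : ℕ := ⌊|ξ| / R⌋₊ with hn
    refine le_trans ?_ (ENNReal.le_tsum n)
    have h1 : (n : ℝ) ≤ |ξ| / R := Nat.floor_le (by positivity)
    have h2 : |ξ| / R < n + 1 := Nat.lt_floor_add_one _
    rw [Set.indicator_of_mem]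
    · refine ENNReal.ofReal_le_ofReal (Real.exp_le_exp.2 ?_)
      have h3 : (n : ℝ) ^ 2 ≤ (|ξ| / R) ^ 2 := by gcongr
      have h4 : (n : ℝ) ≤ (n : ℝ) ^ 2 := by exact_mod_cast Nat.le_self_pow (by norm_num) n
      have h5 : (|ξ| / R) ^ 2 = ξ ^ 2 / R ^ 2 := by rw [div_pow, sq_abs]
      have h6 : ξ ^ 2 / R ^ 2 ≤ Real.pi * (ξ ^ 2 / R ^ 2) :=
        le_mul_of_one_le_left (by positivity) (by linarith [Real.pi_gt_three])
      have h7 : -Real.pi * ξ ^ 2 / R ^ 2 = -(Real.pi * (ξ ^ 2 / R ^ 2)) := by ring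
      linarith
    · rw [Metric.mem_ball, dist_zero_right, Real.norm_eq_abs]
      rwa [div_lt_iff₀ hR, mul_comm] at h2
  have hA := lintegral_normSq_fourierTransform_mul_gaussian μ hR
  have hmeas : Measurable fun ξ => ‖fourierTransform μ ξ‖ₑ ^ 2 :=
    (continuous_fourierTransform μ).measurable.enorm.pow_const 2
  have hB : ∫⁻ ξ : ℝ, ‖fourierTransform μ ξ‖ₑ ^ 2 *
      ENNReal.ofReal (Real.exp (-Real.pi * ξ ^ 2 / R ^ 2)) ≤
      ENNReal.ofReal (S * (|C| * R ^ (1 - s))) := by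
    calc _ ≤ ∫⁻ ξ : ℝ, ∑' n : ℕ, (Metric.ball (0 : ℝ) (R * (n + 1))).indicator
          (fun ξ => ENNReal.ofReal (Real.exp (-n)) * ‖fourierTransform μ ξ‖ₑ ^ 2) ξ := by
          refine lintegral_mono fun ξ => (mul_le_mul_right (hpt ξ) _).trans ?_
          rw [← ENNReal.tsum_mul_left]
          refine ENNReal.tsum_le_tsum fun n => ?_
          by_cases hx : ξ ∈ Metric.ball (0 : ℝ) (R * (n + 1))
          · rw [Set.indicator_of_mem hx, Set.indicator_of_mem hx, mul_comm]
          · rw [Set.indicator_of_notMem hx, Set.indicator_of_notMem hx, mul_zero]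
      _ = ∑' n : ℕ, ENNReal.ofReal (Real.exp (-n)) *
            ∫⁻ ξ in Metric.ball (0 : ℝ) (R * (n + 1)), ‖fourierTransform μ ξ‖ₑ ^ 2 := by
          rw [lintegral_tsum fun n =>
            ((hmeas.const_mul _).indicator measurableSet_ball).aemeasurable]
          congr 1
          ext n
          rw [lintegral_indicator measurableSet_ball, lintegral_const_mul _ hmeas]
      _ ≤ ∑' n : ℕ, ENNReal.ofReal (Real.exp (-n) * ((n : ℝ) + 1) * (|C| * R ^ (1 - s))) := by
          refine ENNReal.tsum_le_tsum fun n => ?_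
          refine (mul_le_mul_right (hball _ (by positivity)) _).trans ?_
          rw [← ENNReal.ofReal_mul (Real.exp_pos _).le]
          refine ENNReal.ofReal_le_ofReal ?_
          rw [Real.mul_rpow hR.le (by positivity)]
          have : ((n : ℝ) + 1) ^ (1 - s) ≤ (n : ℝ) + 1 := by
            have h1 : (1 : ℝ) ≤ (n : ℝ) + 1 := by linarith [(Nat.cast_nonneg n : (0 : ℝ) ≤ n)]
            simpa using Real.rpow_le_rpow_of_exponent_le h1 (show 1 - s ≤ 1 by linarith)
          calc Real.exp (-n) * (|C| * (R ^ (1 - s) * ((n : ℝ) + 1) ^ (1 - s)))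
              ≤ Real.exp (-n) * (|C| * (R ^ (1 - s) * ((n : ℝ) + 1))) := by gcongr
            _ = _ := by ring
      _ = _ := by
          rw [← ENNReal.ofReal_tsum_of_nonneg (fun n => by positivity) (hsum.mul_right _),
            tsum_mul_right]
  rw [hA] at hB
  have h1 : gaussEnergy μ R ≤ ENNReal.ofReal (S * (|C| * R ^ (1 - s))) / ENNReal.ofReal R := by
    rw [ENNReal.le_div_iff_mul_le (.inl (by simpa using hR)) (.inl (by simp)), mul_comm]
    exact hB
  refine h1.trans ?_
  rw [← ENNReal.ofReal_div_of_pos hR]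
  refine ENNReal.ofReal_le_ofReal ?_
  rw [show 1 - s = 1 + -s by ring, Real.rpow_add hR, Real.rpow_one]
  have : 0 ≤ R ^ (-s) := by positivity
  rw [show S * (|C| * (R * R ^ (-s))) / R = S * |C| * R ^ (-s) by field_simp]
  nlinarith

/-! ### The bilinear estimate -/

lemma integral_gaussian_translate_mul_kernel (η x : ℝ) :
    ∫ v : ℝ, (Real.exp (-Real.pi * (η - v) ^ 2) : ℂ) *
      Complex.exp (-2 * Real.pi * Complex.I * v * x) =
    Complex.exp (-2 * Real.pi * Complex.I * η * x) * (Real.exp (-Real.pi * x ^ 2) : ℂ) := by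
  rw [← integral_add_right_eq_self _ η]
  have h := fourier_gaussian_scaled one_pos x
  simp only [one_pow, mul_one, div_one, one_mul] at h
  rw [← h, ← integral_const_mul]
  congr 1
  ext v
  rw [← mul_assoc, ← Complex.exp_add, mul_comm]
  congr 2
  · push_cast; ring
  · congr 2; ring

/-- The measure with density `exp (π x²)` with respect to `μ`. -/
def gaussTilt (μ : Measure ℝ) : Measure ℝ :=
  μ.withDensity fun x => ENNReal.ofReal (Real.exp (Real.pi * x ^ 2))

lemma gaussTilt_le {μ : Measure ℝ} {a b : ℝ} (ha : 0 < a) (h : ∀ᵐ x ∂μ, x ∈ Set.Icc a b) :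
    gaussTilt μ ≤ ENNReal.ofReal (Real.exp (Real.pi * b ^ 2)) • μ := by
  rw [← withDensity_const, gaussTilt]
  refine withDensity_mono ?_
  filter_upwards [h] with x hx
  have := ha.le.trans hx.1
  have := hx.2
  have := Real.pi_pos
  gcongr

lemma isFiniteMeasure_gaussTilt {μ : Measure ℝ} [IsFiniteMeasure μ] {a b : ℝ} (ha : 0 < a)
    (h : ∀ᵐ x ∂μ, x ∈ Set.Icc a b) : IsFiniteMeasure (gaussTilt μ) := by
  have : IsFiniteMeasure (ENNReal.ofReal (Real.exp (Real.pi * b ^ 2)) • μ) :=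
    Measure.smul_finite _ ENNReal.ofReal_ne_top
  exact isFiniteMeasure_of_le _ (gaussTilt_le ha h)

/-- Uncertainty principle: multiplying the tilted measure by `exp (-π x²)` gives `μ` back, and on
the Fourier side this is convolution with a unit-scale Gaussian. -/
lemma fourierTransform_eq_integral_gaussTilt (μ : Measure ℝ) [IsFiniteMeasure (gaussTilt μ)]
    (η : ℝ) : fourierTransform μ η =
      ∫ v : ℝ, (Real.exp (-Real.pi * (η - v) ^ 2) : ℂ) * fourierTransform (gaussTilt μ) v := by
  have h1 : fourierTransform μ η = ∫ x : ℝ, Complex.exp (-2 * Real.pi * Complex.I * η * x) *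
      (Real.exp (-Real.pi * x ^ 2) : ℂ) ∂(gaussTilt μ) := by
    rw [gaussTilt, integral_withDensity_eq_integral_toReal_smul (by fun_prop)
      (.of_forall fun x => ENNReal.ofReal_lt_top)]
    unfold fourierTransform
    congr 1
    ext x
    rw [ENNReal.toReal_ofReal (Real.exp_pos _).le, Complex.real_smul, mul_left_comm,
      ← Complex.ofReal_mul, ← Real.exp_add]
    ring_nf
    simp
  rw [h1]
  simp_rw [← integral_gaussian_translate_mul_kernel]
  rw [integral_integral_swap]
  · congr 1
    ext v
    rw [integral_const_mul]
    rfl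
  · have h0 : Integrable fun v : ℝ => Real.exp (-Real.pi * (η - v) ^ 2) := by
      have := (integrable_exp_neg_mul_sq Real.pi_pos).comp_sub_left η
      exact this
    have h1 : Integrable (fun w : ℝ × ℝ => Real.exp (-Real.pi * (η - w.2) ^ 2))
        ((gaussTilt μ).prod volume) := h0.comp_snd _
    refine h1.mono' (Continuous.aestronglyMeasurable
      (by simp only [Function.uncurry_def]; fun_prop)) (.of_forall fun w => ?_)
    simp only [Function.uncurry]
    rw [norm_mul, norm_fourier_kernel, mul_one, Complex.norm_real, Real.norm_eq_abs,
      abs_of_pos (Real.exp_pos _)]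

/-- Part of the Gaussian concentrated at `η` is spent on confining `v` to scale `R`. -/
lemma exp_neg_sq_sub_le {R η v : ℝ} (hR : 1 ≤ R) (hη : |η| ≤ R) :
    Real.exp (-Real.pi * (η - v) ^ 2) ≤ Real.exp (Real.pi / 2) *
      (Real.exp (-(Real.pi / 2) * (η - v) ^ 2) * Real.exp (-(Real.pi / 4) * v ^ 2 / R ^ 2)) := by
  rw [← Real.exp_add, ← Real.exp_add, Real.exp_le_exp]
  have hpi := Real.pi_pos
  have h1 : η ^ 2 ≤ R ^ 2 := sq_le_sq' (by linarith [neg_abs_le η]) (by linarith [le_abs_self η])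
  have h2 : (1 : ℝ) ≤ R ^ 2 := one_le_pow₀ hR
  have h3 : v ^ 2 / R ^ 2 ≤ 2 + 2 * (η - v) ^ 2 := by
    rw [div_le_iff₀ (by positivity)]
    nlinarith [sq_nonneg (v - 2 * η), mul_nonneg (sq_nonneg (η - v)) (sub_nonneg.2 h2)]
  have h4 : -(Real.pi / 4) * v ^ 2 / R ^ 2 = -(Real.pi / 4) * (v ^ 2 / R ^ 2) := by ring
  rw [h4]
  nlinarith

lemma lintegral_gaussian_mul_gaussian (A B : ℝ) :
    ∫⁻ v : ℝ, ENNReal.ofReal (Real.exp (-(Real.pi / 2) * (A - v) ^ 2)) *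
      ENNReal.ofReal (Real.exp (-(Real.pi / 2) * (B - v) ^ 2)) =
    ENNReal.ofReal (Real.exp (-(Real.pi / 4) * (A - B) ^ 2)) := by
  have h0 : ∫⁻ v : ℝ, ENNReal.ofReal (Real.exp (-Real.pi * ((A + B) / 2 - v) ^ 2)) = 1 := by
    rw [lintegral_sub_left_eq_self (fun v => ENNReal.ofReal (Real.exp (-Real.pi * v ^ 2))),
      ← ofReal_integral_eq_lintegral_ofReal (integrable_exp_neg_mul_sq Real.pi_pos)
        (.of_forall fun v => (Real.exp_pos _).le), integral_gaussian]
    simp [Real.pi_ne_zero]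
  rw [← mul_one (ENNReal.ofReal _), ← h0, ← lintegral_const_mul _ (by fun_prop)]
  congr 1
  ext v
  rw [← ENNReal.ofReal_mul (Real.exp_pos _).le, ← ENNReal.ofReal_mul (Real.exp_pos _).le,
    ← Real.exp_add, ← Real.exp_add]
  ring_nf

/-- Open the square and integrate in `v`; the resulting exponent `π/4 = π (1/2)²` explains the scale
`1 / 2`. -/
lemma lintegral_sq_lintegral_gaussian (μ : Measure ℝ) [SFinite μ] {f : ℝ → ℝ} (hf : Measurable f) :
    ∫⁻ v : ℝ, (∫⁻ y, ENNReal.ofReal (Real.exp (-(Real.pi / 2) * (f y - v) ^ 2)) ∂μ) ^ 2 =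
      gaussEnergy (μ.map f) (1 / 2) := by
  have h1 : ∀ v : ℝ, (∫⁻ y, ENNReal.ofReal (Real.exp (-(Real.pi / 2) * (f y - v) ^ 2)) ∂μ) ^ 2 =
      ∫⁻ z, ENNReal.ofReal (Real.exp (-(Real.pi / 2) * (z.1 - v) ^ 2)) *
        ENNReal.ofReal (Real.exp (-(Real.pi / 2) * (z.2 - v) ^ 2))
        ∂((μ.map f).prod (μ.map f)) := by
    intro v
    rw [lintegral_prod_mul
      (f := fun y => ENNReal.ofReal (Real.exp (-(Real.pi / 2) * (y - v) ^ 2)))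
      (g := fun y => ENNReal.ofReal (Real.exp (-(Real.pi / 2) * (y - v) ^ 2)))
      (by fun_prop) (by fun_prop), lintegral_map (by fun_prop) hf, pow_two]
  simp_rw [h1]
  rw [lintegral_lintegral_swap (by simp only [Function.uncurry_def]; fun_prop)]
  simp_rw [lintegral_gaussian_mul_gaussian]
  rw [lintegral_prod _ (by fun_prop), gaussEnergy]
  ring_nf

/-- A bilinear estimate: the average of `|μ̂ (M / y)|` over `μ` beats the trivial bound as soon as
the energy exponent exceeds `1 / 2`. -/
lemma exists_lintegral_fourierTransform_div_le (μ : Measure ℝ) [IsProbabilityMeasure μ]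
    {a b s D : ℝ} (ha : 0 < a) (hab : a ≤ b) (hD : 0 < D) (hsupp : ∀ᵐ x ∂μ, x ∈ Set.Icc a b)
    (hE : ∀ R : ℝ, 0 < R → gaussEnergy μ R ≤ ENNReal.ofReal (D * R ^ (-s))) :
    ∃ C : ℝ, 0 < C ∧ ∀ M : ℝ, a ≤ M →
      ∫⁻ y, ‖fourierTransform μ (M / y)‖ₑ ∂μ ≤ ENNReal.ofReal (C * M ^ (1 / 2 - s)) := by
  have hb : 0 < b := ha.trans_le hab
  have := isFiniteMeasure_gaussTilt ha hsupp
  set K : ℝ := Real.exp (Real.pi * b ^ 2) with hK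
  set C₁ : ℝ := D * (1 / b ^ 2 / 2) ^ (-s) with hC₁
  set C₂ : ℝ := K ^ 2 * (D * (√2 / a) ^ (1 - s)) with hC₂
  have hC₁0 : 0 < C₁ := by positivity
  have hC₂0 : 0 < C₂ := by positivity
  refine ⟨Real.exp (Real.pi / 2) * (C₁ ^ (1 / 2 : ℝ) * C₂ ^ (1 / 2 : ℝ)), by positivity,
    fun M hM => ?_⟩
  have hM0 : 0 < M := ha.trans_le hM
  -- The largest frequency `M / y` that occurs for `y ≥ a`.
  set R : ℝ := M / a with hR
  have hR1 : 1 ≤ R := by rwa [hR, one_le_div ha]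
  have hR0 : 0 < R := by positivity
  set Ψ : ℝ → ℝ≥0∞ := fun v =>
    ∫⁻ y, ENNReal.ofReal (Real.exp (-(Real.pi / 2) * (M / y - v) ^ 2)) ∂μ with hΨ
  set H : ℝ → ℝ≥0∞ := fun v => ENNReal.ofReal (Real.exp (-(Real.pi / 4) * v ^ 2 / R ^ 2)) *
    ‖fourierTransform (gaussTilt μ) v‖ₑ with hH
  have hmT : Measurable fun v => ‖fourierTransform (gaussTilt μ) v‖ₑ :=
    (continuous_fourierTransform _).measurable.enorm
  have hHm : Measurable H := by
    refine Measurable.mul (by fun_prop) hmT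
  have hkm : Measurable fun w : ℝ × ℝ =>
      ENNReal.ofReal (Real.exp (-(Real.pi / 2) * (M / w.1 - w.2) ^ 2)) := by fun_prop
  have hΨm : Measurable Ψ := hkm.lintegral_prod_left'
  have hΨ2 : ∫⁻ v, Ψ v ^ (2 : ℝ) ≤ ENNReal.ofReal (C₁ * M ^ (-s)) := by
    simp_rw [ENNReal.rpow_two]
    rw [hΨ, lintegral_sq_lintegral_gaussian μ (f := fun y => M / y) (by fun_prop)]
    -- On `[a, b]` the map `y ↦ M / y` has slope at least `M / b²` in modulus.
    refine (gaussEnergy_map_le (by fun_prop) (c := M * (1 / b ^ 2)) (by positivity) hsupp ?_ _).trans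
      ((hE _ (by positivity)).trans (ENNReal.ofReal_le_ofReal (le_of_eq ?_)))
    · intro x hx y hy
      have hx0 : 0 < x := ha.trans_le hx.1
      have hy0 : 0 < y := ha.trans_le hy.1
      rw [show M / x - M / y = M * (y - x) / (x * y) by field_simp, abs_div, abs_mul,
        abs_of_pos hM0, abs_of_pos (mul_pos hx0 hy0), abs_sub_comm y x,
        show M * (1 / b ^ 2) * |x - y| = M * |x - y| / b ^ 2 by ring, pow_two]
      gcongr
      · exact hx.2
      · exact hy.2
    · rw [show M * (1 / b ^ 2) * (1 / 2) = (1 / b ^ 2 / 2) * M by ring,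
        Real.mul_rpow (by positivity) hM0.le, hC₁]
      ring
  have hH2 : ∫⁻ v, H v ^ (2 : ℝ) ≤ ENNReal.ofReal (C₂ * M ^ (1 - s)) := by
    have e : ∀ v, H v ^ (2 : ℝ) = ‖fourierTransform (gaussTilt μ) v‖ₑ ^ 2 *
        ENNReal.ofReal (Real.exp (-Real.pi * v ^ 2 / (√2 * R) ^ 2)) := by
      intro v
      rw [ENNReal.rpow_two, hH, mul_pow, mul_comm, ← ENNReal.ofReal_pow (Real.exp_pos _).le,
        ← Real.exp_nat_mul, mul_pow, Real.sq_sqrt (by norm_num)]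
      congr 3
      push_cast
      field_simp
      ring
    simp_rw [e]
    have hR2 : 0 < √2 * R := by positivity
    rw [lintegral_normSq_fourierTransform_mul_gaussian _ hR2]
    have h1 : gaussEnergy (gaussTilt μ) (√2 * R) ≤
        ENNReal.ofReal (K ^ 2 * (D * (√2 * R) ^ (-s))) := by
      refine (gaussEnergy_mono (gaussTilt_le ha hsupp) _).trans ?_
      rw [gaussEnergy_smul ENNReal.ofReal_ne_top, ENNReal.ofReal_mul (by positivity),
        ENNReal.ofReal_pow (by positivity)]
      gcongr
      exact hE _ hR2
    refine (mul_le_mul_right h1 _).trans ?_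
    rw [← ENNReal.ofReal_mul hR2.le]
    refine ENNReal.ofReal_le_ofReal (le_of_eq ?_)
    have h2 : (√2 / a) ^ (1 - s) * M ^ (1 - s) = √2 * R * (√2 * R) ^ (-s) := by
      rw [← Real.mul_rpow (by positivity) hM0.le,
        show √2 / a * M = √2 * R by rw [hR]; ring, show 1 - s = 1 + -s by ring,
        Real.rpow_add hR2, Real.rpow_one]
    rw [hC₂, mul_assoc (K ^ 2), mul_assoc D, h2]
    ring
  calc ∫⁻ y, ‖fourierTransform μ (M / y)‖ₑ ∂μ
      ≤ ∫⁻ y, (∫⁻ v, ENNReal.ofReal (Real.exp (Real.pi / 2)) *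
        (ENNReal.ofReal (Real.exp (-(Real.pi / 2) * (M / y - v) ^ 2)) * H v)) ∂μ := by
        refine lintegral_mono_ae ?_
        filter_upwards [hsupp] with y hy
        have hy0 : 0 < y := ha.trans_le hy.1
        rw [fourierTransform_eq_integral_gaussTilt]
        refine (enorm_integral_le_lintegral_enorm _).trans (lintegral_mono fun v => ?_)
        rw [enorm_mul, ← mul_assoc, hH, ← mul_assoc]
        gcongr
        rw [← ENNReal.ofReal_mul (by positivity), ← ENNReal.ofReal_mul (by positivity),
          ← ofReal_norm, Complex.norm_real, Real.norm_eq_abs, abs_of_pos (Real.exp_pos _),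
          mul_assoc]
        refine ENNReal.ofReal_le_ofReal (exp_neg_sq_sub_le hR1 ?_)
        rw [abs_of_pos (by positivity), hR]
        exact div_le_div_of_nonneg_left hM0.le ha hy.1
    _ = ENNReal.ofReal (Real.exp (Real.pi / 2)) * ∫⁻ v, Ψ v * H v := by
        rw [lintegral_lintegral_swap, ← lintegral_const_mul (f := fun v => Ψ v * H v) _ (hΨm.mul hHm)]
        · congr 1
          ext v
          rw [lintegral_const_mul _ (by fun_prop), lintegral_mul_const _ (by fun_prop)]
        · exact ((hkm.mul (hHm.comp measurable_snd)).const_mul _).aemeasurable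
    -- Cauchy–Schwarz in `v`: the factors have squared norms `O(M^(-s))` and `O(M^(1-s))`.
    _ ≤ ENNReal.ofReal (Real.exp (Real.pi / 2)) * (ENNReal.ofReal (C₁ * M ^ (-s)) ^ (1 / 2 : ℝ) *
          ENNReal.ofReal (C₂ * M ^ (1 - s)) ^ (1 / 2 : ℝ)) := by
        gcongr
        refine (ENNReal.lintegral_mul_le_Lp_mul_Lq volume Real.HolderConjugate.two_two
          hΨm.aemeasurable hHm.aemeasurable).trans ?_
        gcongr
    _ = _ := by
        rw [ENNReal.ofReal_rpow_of_nonneg (by positivity) (by norm_num),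
          ENNReal.ofReal_rpow_of_nonneg (by positivity) (by norm_num),
          ← ENNReal.ofReal_mul (by positivity), ← ENNReal.ofReal_mul (by positivity)]
        congr 1
        rw [Real.mul_rpow hC₁0.le (by positivity), Real.mul_rpow hC₂0.le (by positivity),
          ← Real.rpow_mul hM0.le, ← Real.rpow_mul hM0.le,
          show (1 / 2 - s : ℝ) = -s * (1 / 2) + (1 - s) * (1 / 2) by ring, Real.rpow_add hM0]
        ring

/-! ### Linearising the logarithm on a cylinder -/

lemma abs_log_sub_log_sub_le {a u v : ℝ} (ha : 0 < a) (hu : a ≤ u) (hv : a ≤ v) :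
    |Real.log u - Real.log v - (u - v) / v| ≤ (u - v) ^ 2 / a ^ 2 := by
  have hu0 : 0 < u := ha.trans_le hu
  have hv0 : 0 < v := ha.trans_le hv
  have h1 : Real.log u - Real.log v ≤ u / v - 1 := by
    rw [← Real.log_div hu0.ne' hv0.ne']
    exact Real.log_le_sub_one_of_pos (by positivity)
  have h2 : 1 - (u / v)⁻¹ ≤ Real.log u - Real.log v := by
    rw [← Real.log_div hu0.ne' hv0.ne']
    exact Real.one_sub_inv_le_log_of_pos (by positivity)
  have h3 : (u - v) / v = u / v - 1 := by field_simp
  have h4 : (u - v) / v - (1 - (u / v)⁻¹) = (u - v) ^ 2 / (u * v) := by field_simp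
  have h5 : (u - v) ^ 2 / (u * v) ≤ (u - v) ^ 2 / a ^ 2 := by
    rw [pow_two a]
    gcongr
  have h6 : 0 ≤ (u - v) ^ 2 / a ^ 2 := by positivity
  rw [abs_le]
  constructor <;> linarith

lemma norm_fourier_kernel_sub_le (ξ x y : ℝ) :
    ‖Complex.exp (-2 * Real.pi * Complex.I * ξ * x) -
      Complex.exp (-2 * Real.pi * Complex.I * ξ * y)‖ ≤ 2 * Real.pi * |ξ| * |x - y| := by
  have h : Complex.exp (-2 * Real.pi * Complex.I * ξ * x) -
      Complex.exp (-2 * Real.pi * Complex.I * ξ * y) =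
      Complex.exp (-2 * Real.pi * Complex.I * ξ * y) *
        (Complex.exp (Complex.I * ((-2 * Real.pi * ξ * (x - y) : ℝ) : ℂ)) - 1) := by
    rw [mul_sub, ← Complex.exp_add, mul_one]
    congr 2
    push_cast
    ring
  rw [h, norm_mul, norm_fourier_kernel, one_mul]
  refine (Real.norm_exp_I_mul_ofReal_sub_one_le).trans (le_of_eq ?_)
  rw [Real.norm_eq_abs, abs_mul, abs_mul, abs_mul, abs_neg, abs_of_pos Real.pi_pos]
  norm_num

/-- Replacing `log` by its tangent at `ρ * x₀ + t` leaves a linear phase, whose integral is a value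
of `μ̂` up to a unimodular factor. The sign of `ρ` is irrelevant because `|μ̂|` is even. -/
lemma norm_integral_kernel_log_affine_le (μ : Measure ℝ) [IsProbabilityMeasure μ]
    {a b : ℝ} (ha : 0 < a) (hsupp : ∀ᵐ x ∂μ, x ∈ Set.Icc a b) {ρ t δ ξ : ℝ} (hρ : |ρ| ≤ δ)
    (hξ : 0 ≤ ξ) (hf : ∀ᵐ x ∂μ, ρ * x + t ∈ Set.Icc a b) {x₀ : ℝ} (hx₀ : x₀ ∈ Set.Icc a b)
    (hfx₀ : ρ * x₀ + t ∈ Set.Icc a b) :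
    ‖∫ x, Complex.exp (-2 * Real.pi * Complex.I * ξ * (Real.log (ρ * x + t) : ℝ)) ∂μ‖ ≤
      ‖fourierTransform μ (ξ * |ρ| / (ρ * x₀ + t))‖ +
        2 * Real.pi * b ^ 2 / a ^ 2 * (ξ * δ ^ 2) := by
  set u₀ := ρ * x₀ + t with hu₀
  have hu₀' : 0 < u₀ := ha.trans_le hfx₀.1
  have habs : ‖fourierTransform μ (ξ * |ρ| / u₀)‖ = ‖fourierTransform μ (ξ * ρ / u₀)‖ := by
    rcases abs_choice ρ with h | h
    · rw [h]
    · rw [h, mul_neg, neg_div, norm_fourierTransform_neg]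
  have hlin : ‖∫ x, Complex.exp (-2 * Real.pi * Complex.I * ξ *
      ((Real.log u₀ + ρ * (x - x₀) / u₀ : ℝ) : ℂ)) ∂μ‖ = ‖fourierTransform μ (ξ * ρ / u₀)‖ := by
    have e : ∀ x : ℝ, Complex.exp (-2 * Real.pi * Complex.I * ξ *
        ((Real.log u₀ + ρ * (x - x₀) / u₀ : ℝ) : ℂ)) =
        Complex.exp (-2 * Real.pi * Complex.I * ξ * ((Real.log u₀ - ρ * x₀ / u₀ : ℝ) : ℂ)) *
          Complex.exp (-2 * Real.pi * Complex.I * ((ξ * ρ / u₀ : ℝ) : ℂ) * x) := by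
      intro x
      rw [← Complex.exp_add]
      congr 1
      push_cast
      ring
    simp_rw [e]
    rw [integral_const_mul, norm_mul, norm_fourier_kernel, one_mul]
    rfl
  rw [habs, ← hlin]
  refine (norm_le_insert' _ (∫ x, Complex.exp (-2 * Real.pi * Complex.I * ξ *
    ((Real.log u₀ + ρ * (x - x₀) / u₀ : ℝ) : ℂ)) ∂μ)).trans ?_
  gcongr
  rw [← integral_sub]
  · have : 2 * Real.pi * b ^ 2 / a ^ 2 * (ξ * δ ^ 2) =
        (2 * Real.pi * b ^ 2 / a ^ 2 * (ξ * δ ^ 2)) * μ.real Set.univ := by simp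
    rw [this]
    refine norm_integral_le_of_norm_le_const ?_
    filter_upwards [hsupp, hf] with x hx hfx
    refine (norm_fourier_kernel_sub_le _ _ _).trans ?_
    have h1 := abs_log_sub_log_sub_le ha hfx.1 hfx₀.1
    rw [show ρ * x + t - u₀ = ρ * (x - x₀) by rw [hu₀]; ring, sub_sub] at h1
    have h2 : (ρ * (x - x₀)) ^ 2 ≤ (δ * b) ^ 2 := by
      rw [← sq_abs, abs_mul]
      have h3 : |x - x₀| ≤ b := by
        rw [abs_le]
        constructor <;> linarith [hx.1, hx.2, hx₀.1, hx₀.2]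
      have h4 := (abs_nonneg ρ).trans hρ
      gcongr
    rw [abs_of_nonneg hξ]
    calc 2 * Real.pi * ξ * |Real.log (ρ * x + t) - (Real.log u₀ + ρ * (x - x₀) / u₀)|
        ≤ 2 * Real.pi * ξ * ((δ * b) ^ 2 / a ^ 2) := by
          gcongr
          exact h1.trans (by gcongr)
      _ = _ := by ring
  · exact Integrable.of_bound (Measurable.aestronglyMeasurable (by fun_prop)) 1
      (.of_forall fun x => (norm_fourier_kernel ξ _).le)
  · exact Integrable.of_bound (Measurable.aestronglyMeasurable (by fun_prop)) 1
      (.of_forall fun x => (norm_fourier_kernel ξ _).le)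

/-- The left side does not depend on the base point of the linearisation, so the pointwise bound may
be averaged over base points. -/
lemma enorm_integral_kernel_log_affine_le (μ : Measure ℝ) [IsProbabilityMeasure μ]
    {a b : ℝ} (ha : 0 < a) (hsupp : ∀ᵐ x ∂μ, x ∈ Set.Icc a b) {ρ t δ ξ : ℝ} (hρ : |ρ| ≤ δ)
    (hξ : 0 ≤ ξ) (hf : ∀ᵐ x ∂μ, ρ * x + t ∈ Set.Icc a b) :
    ‖∫ x, Complex.exp (-2 * Real.pi * Complex.I * ξ * (Real.log (ρ * x + t) : ℝ)) ∂μ‖ₑ ≤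
      ∫⁻ x, ‖fourierTransform μ (ξ * |ρ| / (ρ * x + t))‖ₑ ∂μ +
        ENNReal.ofReal (2 * Real.pi * b ^ 2 / a ^ 2 * (ξ * δ ^ 2)) := by
  set I := ∫ x, Complex.exp (-2 * Real.pi * Complex.I * ξ * (Real.log (ρ * x + t) : ℝ)) ∂μ
  calc ‖I‖ₑ = ∫⁻ _, ‖I‖ₑ ∂μ := by simp
    _ ≤ ∫⁻ x, (‖fourierTransform μ (ξ * |ρ| / (ρ * x + t))‖ₑ +
          ENNReal.ofReal (2 * Real.pi * b ^ 2 / a ^ 2 * (ξ * δ ^ 2))) ∂μ := by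
        refine lintegral_mono_ae ?_
        filter_upwards [hsupp, hf] with x hx hfx
        rw [← ofReal_norm, ← ofReal_norm, ← ENNReal.ofReal_add (norm_nonneg _) (by positivity)]
        exact ENNReal.ofReal_le_ofReal
          (norm_integral_kernel_log_affine_le μ ha hsupp hρ hξ hf hx hfx)
    _ = _ := by rw [lintegral_add_right _ measurable_const]; simp

/-! ### Decomposition into cylinders -/

section SelfSimilar

lemma SimilarityIFS.measurable_toFun {N : ℕ} (Λ : SimilarityIFS N) (i : Fin N) :
    Measurable (Λ.toFun i) := by
  unfold SimilarityIFS.toFun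
  fun_prop

variable {N : ℕ} {Λ : SimilarityIFS N} {p : Fin N → ℝ} {μ : Measure ℝ}

lemma ae_comp_toFun_of_selfSimilar (hp : ∀ i, 0 < p i)
    (hμ : μ = ∑ i, ENNReal.ofReal (p i) • μ.map (Λ.toFun i)) {P : ℝ → Prop}
    (h : ∀ᵐ x ∂μ, P x) (i : Fin N) : ∀ᵐ x ∂μ, P (Λ.toFun i x) := by
  have hle : ENNReal.ofReal (p i) • μ.map (Λ.toFun i) ≤ μ := by
    conv_rhs => rw [hμ]
    exact Finset.single_le_sum (f := fun i => ENNReal.ofReal (p i) • μ.map (Λ.toFun i))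
      (fun _ _ => Measure.zero_le _) (Finset.mem_univ i)
  have h1 : ∀ᵐ x ∂(μ.map (Λ.toFun i)), P x := by
    have h2 := (Measure.absolutelyContinuous_of_le hle).ae_le h
    rwa [Measure.ae_ennreal_smul_measure_eq (by simpa using hp i)] at h2
  exact ae_of_ae_map (Λ.measurable_toFun i).aemeasurable h1

lemma lintegral_eq_sum_of_selfSimilar
    (hμ : μ = ∑ i, ENNReal.ofReal (p i) • μ.map (Λ.toFun i)) {g : ℝ → ℝ≥0∞} (hg : Measurable g) :
    ∫⁻ x, g x ∂μ = ∑ i, ENNReal.ofReal (p i) * ∫⁻ x, g (Λ.toFun i x) ∂μ := by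
  conv_lhs => rw [hμ]
  rw [lintegral_finsetSum_measure]
  refine Finset.sum_congr rfl fun i _ => ?_
  rw [lintegral_smul_measure, smul_eq_mul, lintegral_map hg (Λ.measurable_toFun i)]

lemma enorm_integral_le_sum_of_selfSimilar [IsFiniteMeasure μ]
    (hμ : μ = ∑ i, ENNReal.ofReal (p i) • μ.map (Λ.toFun i)) {g : ℝ → ℂ} (hg : Measurable g)
    {C : ℝ} (hC : ∀ x, ‖g x‖ ≤ C) :
    ‖∫ x, g x ∂μ‖ₑ ≤ ∑ i, ENNReal.ofReal (p i) * ‖∫ x, g (Λ.toFun i x) ∂μ‖ₑ := by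
  conv_lhs => rw [hμ]
  rw [integral_finsetSum_measure]
  · refine (enorm_sum_le _ _).trans (Finset.sum_le_sum fun i _ => le_of_eq ?_)
    rw [integral_smul_measure, integral_map (Λ.measurable_toFun i).aemeasurable
      hg.aestronglyMeasurable, enorm_smul]
    congr 1
    rw [Real.enorm_eq_ofReal ENNReal.toReal_nonneg, ENNReal.ofReal_toReal ENNReal.ofReal_ne_top]
  · intro i _
    have : IsFiniteMeasure (ENNReal.ofReal (p i) • μ.map (Λ.toFun i)) :=
      Measure.smul_finite _ ENNReal.ofReal_ne_top
    exact Integrable.of_bound hg.aestronglyMeasurable C (.of_forall hC)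

/-- The contraction ratios of cylinders of depth at most `L` lying in `(δ m, δ]`. -/
def SimilarityIFS.cylinderRatios (Λ : SimilarityIFS N) (L : ℕ) (m δ : ℝ) : Finset ℝ :=
  ((Fintype.piFinset fun _ : Fin N => Finset.range (L + 1)).image
    fun k => ∏ i, Λ.r i ^ k i).filter fun r => δ * m < r ∧ r ≤ δ

lemma SimilarityIFS.card_cylinderRatios_le (Λ : SimilarityIFS N) (L : ℕ) (m δ : ℝ) :
    (Λ.cylinderRatios L m δ).card ≤ (L + 1) ^ N := by
  refine (Finset.card_filter_le _ _).trans (Finset.card_image_le.trans ?_)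
  simp [Fintype.card_piFinset]

/-- A stopping-time argument: subdivide until the ratio first drops to at most `δ`; it then exceeds
`δ * m`, and `q ^ L ≤ δ` forces stopping within `L` steps. Summing over all admissible ratios makes
the integrand the same function of the position for every cylinder, so self-similarity reassembles
the averages. A ratio depends only on how often each map is used, which keeps their number
polynomial in `L`. -/
lemma enorm_integral_kernel_log_le_of_selfSimilar_aux [IsProbabilityMeasure μ]
    (hp : ∀ i, 0 < p i) (hp1 : ∑ i, p i = 1)
    (hμ : μ = ∑ i, ENNReal.ofReal (p i) • μ.map (Λ.toFun i))
    {a b : ℝ} (ha : 0 < a) (hsupp : ∀ᵐ x ∂μ, x ∈ Set.Icc a b)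
    {m q δ ξ : ℝ} (hm : ∀ i, m ≤ Λ.r i) (hm0 : 0 < m) (hq : ∀ i, Λ.r i ≤ q) {L : ℕ}
    (hδ : q ^ L ≤ δ) (hξ : 0 ≤ ξ) (n : ℕ) :
    ∀ (k : Fin N → ℕ) (ρ t : ℝ), ∑ i, k i + n = L → |ρ| = ∏ i, Λ.r i ^ k i → δ * m < |ρ| →
      (∀ᵐ x ∂μ, ρ * x + t ∈ Set.Icc a b) →
      ‖∫ x, Complex.exp (-2 * Real.pi * Complex.I * ξ * (Real.log (ρ * x + t) : ℝ)) ∂μ‖ₑ ≤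
        ∫⁻ x, ∑ r ∈ Λ.cylinderRatios L m δ, ‖fourierTransform μ (ξ * r / (ρ * x + t))‖ₑ ∂μ +
          ENNReal.ofReal (2 * Real.pi * b ^ 2 / a ^ 2 * (ξ * δ ^ 2)) := by
  have hG : Measurable fun y : ℝ => ∑ r ∈ Λ.cylinderRatios L m δ,
      ‖fourierTransform μ (ξ * r / y)‖ₑ :=
    Finset.measurable_fun_sum _ fun r _ =>
      ((continuous_fourierTransform μ).measurable.comp (by fun_prop)).enorm
  have hbase : ∀ (k : Fin N → ℕ) (ρ t : ℝ), (∀ i, k i ≤ L) → |ρ| = ∏ i, Λ.r i ^ k i →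
      δ * m < |ρ| → |ρ| ≤ δ → (∀ᵐ x ∂μ, ρ * x + t ∈ Set.Icc a b) →
      ‖∫ x, Complex.exp (-2 * Real.pi * Complex.I * ξ * (Real.log (ρ * x + t) : ℝ)) ∂μ‖ₑ ≤
        ∫⁻ x, ∑ r ∈ Λ.cylinderRatios L m δ, ‖fourierTransform μ (ξ * r / (ρ * x + t))‖ₑ ∂μ +
          ENNReal.ofReal (2 * Real.pi * b ^ 2 / a ^ 2 * (ξ * δ ^ 2)) := by
    intro k ρ t hk hρ hρm hρδ hf
    refine (enorm_integral_kernel_log_affine_le μ ha hsupp hρδ hξ hf).trans ?_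
    gcongr with x
    refine Finset.single_le_sum (f := fun r => ‖fourierTransform μ (ξ * r / (ρ * x + t))‖ₑ)
      (fun _ _ => zero_le) ?_
    refine Finset.mem_filter.2 ⟨Finset.mem_image.2 ⟨k, ?_, hρ.symm⟩, hρm, hρδ⟩
    exact Fintype.mem_piFinset.2 fun i => Finset.mem_range_succ_iff.2 (hk i)
  induction n with
  | zero =>
    intro k ρ t hk hρ hρm hf
    refine hbase k ρ t (fun i => ?_) hρ hρm ?_ hf
    · rw [← hk, add_zero]
      exact Finset.single_le_sum (fun _ _ => Nat.zero_le _) (Finset.mem_univ i)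
    · refine le_trans ?_ hδ
      rw [hρ, ← hk, add_zero, ← Finset.prod_pow_eq_pow_sum]
      exact Finset.prod_le_prod (fun i _ => pow_nonneg (Λ.r_pos i).le _)
        fun i _ => pow_le_pow_left₀ (Λ.r_pos i).le (hq i) _
  | succ n ih =>
    intro k ρ t hk hρ hρm hf
    rcases le_or_gt |ρ| δ with hρδ | hρδ
    · refine hbase k ρ t (fun i => ?_) hρ hρm hρδ hf
      have := Finset.single_le_sum (f := k) (fun _ _ => Nat.zero_le _) (Finset.mem_univ i)
      omega
    set E := ENNReal.ofReal (2 * Real.pi * b ^ 2 / a ^ 2 * (ξ * δ ^ 2))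
    have hstep : ∀ i, ‖∫ x, Complex.exp (-2 * Real.pi * Complex.I * ξ *
        (Real.log (ρ * Λ.toFun i x + t) : ℝ)) ∂μ‖ₑ ≤
        ∫⁻ x, ∑ r ∈ Λ.cylinderRatios L m δ,
          ‖fourierTransform μ (ξ * r / (ρ * Λ.toFun i x + t))‖ₑ ∂μ + E := by
      intro i
      have e : ∀ x, ρ * Λ.toFun i x + t = ρ * (Λ.r i * Λ.O i) * x + (ρ * Λ.t i + t) := by
        intro x
        unfold SimilarityIFS.toFun
        ring
      have hO : |Λ.O i| = 1 := by
        rcases Λ.O_eq i with h | h <;> simp [h]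
      have habs : |ρ * (Λ.r i * Λ.O i)| = |ρ| * Λ.r i := by
        rw [abs_mul, abs_mul, hO, mul_one, abs_of_pos (Λ.r_pos i)]
      have hf' := ae_comp_toFun_of_selfSimilar hp hμ hf i
      simp_rw [e] at hf' ⊢
      refine ih (k + Pi.single i 1) _ _ ?_ ?_ ?_ hf'
      · simp only [Pi.add_apply, Finset.sum_add_distrib, Finset.sum_pi_single',
          Finset.mem_univ, if_true]
        omega
      · rw [habs, hρ]
        simp only [Pi.add_apply, pow_add, Finset.prod_mul_distrib]
        congr 1
        rw [Finset.prod_eq_single i]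
        · simp
        · intro j _ hj
          simp [hj]
        · simp
      · rw [habs]
        exact (mul_lt_mul_of_pos_right hρδ hm0).trans_le
          (mul_le_mul_of_nonneg_left (hm i) (abs_nonneg ρ))
    calc _ ≤ ∑ i, ENNReal.ofReal (p i) * ‖∫ x, Complex.exp (-2 * Real.pi * Complex.I * ξ *
          (Real.log (ρ * Λ.toFun i x + t) : ℝ)) ∂μ‖ₑ :=
          enorm_integral_le_sum_of_selfSimilar hμ (g := fun x => Complex.exp (-2 * Real.pi *
            Complex.I * ξ * (Real.log (ρ * x + t) : ℝ))) (by fun_prop)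
            fun x => (norm_fourier_kernel ξ _).le
      _ ≤ ∑ i, ENNReal.ofReal (p i) * (∫⁻ x, ∑ r ∈ Λ.cylinderRatios L m δ,
          ‖fourierTransform μ (ξ * r / (ρ * Λ.toFun i x + t))‖ₑ ∂μ + E) := by
          gcongr with i
          exact hstep i
      -- The weights sum to one, so the error does not accumulate with depth.
      _ = _ := by
          simp_rw [mul_add]
          rw [Finset.sum_add_distrib, ← Finset.sum_mul,
            ← ENNReal.ofReal_sum_of_nonneg fun i _ => (hp i).le, hp1, ENNReal.ofReal_one, one_mul,
            lintegral_eq_sum_of_selfSimilar hμ (g := fun x => ∑ r ∈ Λ.cylinderRatios L m δ,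
              ‖fourierTransform μ (ξ * r / (ρ * x + t))‖ₑ) (hG.comp (by fun_prop))]

lemma enorm_integral_kernel_log_le_of_selfSimilar [IsProbabilityMeasure μ]
    (hp : ∀ i, 0 < p i) (hp1 : ∑ i, p i = 1)
    (hμ : μ = ∑ i, ENNReal.ofReal (p i) • μ.map (Λ.toFun i))
    {a b : ℝ} (ha : 0 < a) (hsupp : ∀ᵐ x ∂μ, x ∈ Set.Icc a b)
    {m q ξ : ℝ} (hm : ∀ i, m ≤ Λ.r i) (hm0 : 0 < m) (hm1 : m < 1) (hq : ∀ i, Λ.r i ≤ q)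
    (hq0 : 0 < q) (hq1 : q < 1) (hξ : 0 ≤ ξ) (L : ℕ) :
    ‖∫ x, Complex.exp (-2 * Real.pi * Complex.I * ξ * (Real.log x : ℝ)) ∂μ‖ₑ ≤
      ∑ r ∈ Λ.cylinderRatios L m (q ^ L), ∫⁻ x, ‖fourierTransform μ (ξ * r / x)‖ₑ ∂μ +
        ENNReal.ofReal (2 * Real.pi * b ^ 2 / a ^ 2 * (ξ * (q ^ L) ^ 2)) := by
  have h := enorm_integral_kernel_log_le_of_selfSimilar_aux hp hp1 hμ ha hsupp hm hm0 hq
    (le_refl (q ^ L)) hξ L 0 1 0 (by simp) (by simp) (by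
      rw [abs_one]
      exact mul_lt_one_of_nonneg_of_lt_one_right (pow_le_one₀ hq0.le hq1.le) hm0.le hm1)
    (by simpa using hsupp)
  simp only [one_mul, add_zero] at h
  rwa [lintegral_finsetSum] at h
  exact fun r _ => ((continuous_fourierTransform μ).measurable.comp (by fun_prop)).enorm

end SelfSimilar

/-! ### Pointwise decay for the logarithmic image -/

lemma fourierTransform_map_log (μ : Measure ℝ) (ξ : ℝ) :
    fourierTransform (μ.map Real.log) ξ =
      ∫ x, Complex.exp (-2 * Real.pi * Complex.I * ξ * (Real.log x : ℝ)) ∂μ := by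
  rw [fourierTransform, integral_map Real.measurable_log.aemeasurable
    (Continuous.aestronglyMeasurable (by fun_prop))]

lemma exists_succ_pow_le_rpow (N : ℕ) {q η : ℝ} (hq0 : 0 < q) (hq1 : q < 1) (hη : 0 < η) :
    ∃ B : ℝ, 0 < B ∧ ∀ L : ℕ, ((L : ℝ) + 1) ^ N ≤ B * (q ^ L) ^ (-η) := by
  have hx1 : q ^ η < 1 := Real.rpow_lt_one hq0.le hq1 hη
  have hx0 : 0 < q ^ η := by positivity
  have ht := tendsto_pow_const_mul_const_pow_of_abs_lt_one N
    (show |q ^ η| < 1 by rwa [abs_of_pos hx0])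
  obtain ⟨B, hB⟩ := ht.bddAbove_range
  refine ⟨|B| * q ^ (-η) + 1, by positivity, fun L => ?_⟩
  have h1 : ((L + 1 : ℕ) : ℝ) ^ N * (q ^ η) ^ (L + 1) ≤ B := hB ⟨L + 1, rfl⟩
  have h2 : (q ^ η) ^ (L + 1) = q ^ η * (q ^ L) ^ η := by
    rw [pow_succ, mul_comm, ← Real.rpow_natCast, ← Real.rpow_natCast, ← Real.rpow_mul hq0.le,
      ← Real.rpow_mul hq0.le, mul_comm η]
  have h3 : 0 < (q ^ L) ^ (-η) := by positivity
  have h4 : ((L : ℝ) + 1) ^ N = ((L + 1 : ℕ) : ℝ) ^ N * (q ^ η) ^ (L + 1) *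
      (q ^ (-η) * (q ^ L) ^ (-η)) := by
    rw [h2, Real.rpow_neg hq0.le, Real.rpow_neg (by positivity)]
    have : (q ^ L) ^ η ≠ 0 := by positivity
    push_cast
    field_simp
  rw [h4]
  calc _ ≤ |B| * (q ^ (-η) * (q ^ L) ^ (-η)) := by
        gcongr
        exact h1.trans (le_abs_self B)
    _ ≤ _ := by nlinarith

/-- Polynomial Fourier decay of the logarithmic image of a self-similar measure. -/
lemma exists_fourierTransform_map_log_le {N : ℕ} {Λ : SimilarityIFS N} {p : Fin N → ℝ}
    {μ : Measure ℝ} [IsProbabilityMeasure μ] (hp : ∀ i, 0 < p i) (hp1 : ∑ i, p i = 1)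
    (hμ : μ = ∑ i, ENNReal.ofReal (p i) • μ.map (Λ.toFun i))
    {a b s D : ℝ} (ha : 0 < a) (hab : a ≤ b) (hD : 0 < D) (hsupp : ∀ᵐ x ∂μ, x ∈ Set.Icc a b)
    (hs : 1 / 2 < s)
    (hE : ∀ R : ℝ, 0 < R → gaussEnergy μ R ≤ ENNReal.ofReal (D * R ^ (-s))) {η : ℝ} (hη : 0 < η) :
    ∃ C : ℝ, 0 < C ∧ ∀ ξ : ℝ, 1 ≤ ξ → ‖fourierTransform (μ.map Real.log) ξ‖ₑ ≤
      ENNReal.ofReal (C * ξ ^ (-((2 * s - 1) / (3 + 2 * s)) + η)) := by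
  have : Nonempty (Fin N) := ⟨⟨0, by have := Λ.two_le; omega⟩⟩
  obtain ⟨i₀, hi₀⟩ := Finite.exists_min Λ.r
  obtain ⟨i₁, hi₁⟩ := Finite.exists_max Λ.r
  set m := Λ.r i₀
  set q := Λ.r i₁
  have hm0 : 0 < m := Λ.r_pos i₀
  have hm1 : m < 1 := Λ.r_lt_one i₀
  have hq0 : 0 < q := Λ.r_pos i₁
  have hq1 : q < 1 := Λ.r_lt_one i₁
  set σ := (2 * s - 1) / (3 + 2 * s) with hσ
  -- With `δ ≈ ξ ^ (-β)`, this balances the linearisation error `ξ ^ (1 - 2β)` against the main term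
  -- `ξ ^ ((1 - β)(1/2 - s))`; both equal `ξ ^ (-σ)`.
  set β := (1 + σ) / 2 with hβ
  have hs3 : 0 < 3 + 2 * s := by linarith
  have hσ0 : 0 < σ := div_pos (by linarith) hs3
  have hσ1 : σ < 1 := by rw [hσ, div_lt_one hs3]; linarith
  have hβ0 : 0 < β := by rw [hβ]; linarith
  have hβ1 : β < 1 := by rw [hβ]; linarith
  have hβσ : (1 - β) * (1 / 2 - s) = -σ := by
    rw [hβ, hσ]; field_simp; ring
  obtain ⟨C₁, hC₁, hdiv⟩ := exists_lintegral_fourierTransform_div_le μ ha hab hD hsupp hE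
  obtain ⟨B, hB, hcard⟩ := exists_succ_pow_le_rpow N hq0 hq1 hη
  set C₂ := 2 * Real.pi * b ^ 2 / a ^ 2 / q ^ 2 with hC₂
  have hb : 0 < b := ha.trans_le hab
  have hC₂0 : 0 < C₂ := by positivity
  refine ⟨(a / m) ^ (s - 1 / 2) + (B * (C₁ * m ^ (1 / 2 - s)) + C₂), by positivity, fun ξ hξ => ?_⟩
  have hξ0 : 0 < ξ := by linarith
  have hση : ξ ^ (-σ) ≤ ξ ^ (-σ + η) := Real.rpow_le_rpow_of_exponent_le hξ (by linarith)
  obtain ⟨L, hL1, hL2⟩ := exists_nat_pow_near_of_lt_one (x := ξ ^ (-β)) (y := q) (by positivity)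
    (Real.rpow_le_one_of_one_le_of_nonpos hξ (by linarith)) hq0 hq1
  set δ := q ^ L with hδ
  have hδ0 : 0 < δ := by positivity
  have hξβ : ξ * ξ ^ (-β) = ξ ^ (1 - β) := by
    rw [sub_eq_add_neg, Real.rpow_add hξ0, Real.rpow_one]
  have hlow : ξ ^ (1 - β) * m ≤ ξ * (δ * m) := by
    rw [← hξβ, mul_assoc]
    gcongr
  -- The bilinear estimate needs frequency at least `a`. Otherwise `ξ` is bounded and the trivial
  -- bound `1` suffices.
  rcases lt_or_ge (ξ * (δ * m)) a with hsmall | hbig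
  · have := Measure.isProbabilityMeasure_map (μ := μ) Real.measurable_log.aemeasurable
    rw [← ofReal_norm]
    refine ENNReal.ofReal_le_ofReal ((norm_fourierTransform_le_one _ _).trans ?_)
    have h1 : (1 : ℝ) ≤ (a / m) * ξ ^ (-(1 - β)) := by
      rw [Real.rpow_neg hξ0.le, ← div_eq_mul_inv, one_le_div (by positivity), le_div_iff₀ hm0]
      linarith
    have h2 := Real.one_le_rpow h1 (show 0 ≤ s - 1 / 2 by linarith)
    rw [Real.mul_rpow (by positivity) (by positivity), ← Real.rpow_mul hξ0.le,
      show -(1 - β) * (s - 1 / 2) = -σ by rw [← hβσ]; ring] at h2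
    refine h2.trans ?_
    gcongr
    exact le_add_of_nonneg_right (by positivity)
  · rw [fourierTransform_map_log]
    refine (enorm_integral_kernel_log_le_of_selfSimilar hp hp1 hμ ha hsupp hi₀ hm0 hm1 hi₁ hq0 hq1
      hξ0.le L).trans ?_
    have hsum : ∑ r ∈ Λ.cylinderRatios L m δ, ∫⁻ x, ‖fourierTransform μ (ξ * r / x)‖ₑ ∂μ ≤
        ENNReal.ofReal (B * (C₁ * m ^ (1 / 2 - s)) * ξ ^ (-σ + η)) := by
      have hterm : ∀ r ∈ Λ.cylinderRatios L m δ, ∫⁻ x, ‖fourierTransform μ (ξ * r / x)‖ₑ ∂μ ≤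
          ENNReal.ofReal (C₁ * m ^ (1 / 2 - s) * ξ ^ (-σ)) := by
        intro r hr
        have hr' := (Finset.mem_filter.1 hr).2.1.le
        have h1 : ξ * (δ * m) ≤ ξ * r := by gcongr
        refine (hdiv _ (hbig.trans h1)).trans (ENNReal.ofReal_le_ofReal ?_)
        rw [mul_assoc]
        gcongr
        rw [← hβσ, Real.rpow_mul hξ0.le, ← Real.mul_rpow hm0.le (by positivity)]
        exact Real.rpow_le_rpow_of_nonpos (by positivity) (by linarith) (by linarith)
      refine (Finset.sum_le_card_nsmul _ _ _ hterm).trans ?_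
      rw [nsmul_eq_mul, ← ENNReal.ofReal_natCast, ← ENNReal.ofReal_mul (Nat.cast_nonneg _)]
      refine ENNReal.ofReal_le_ofReal ?_
      -- The number of ratios is polynomial in `log ξ`, and costs only `ξ ^ η`.
      have hc : ((Λ.cylinderRatios L m δ).card : ℝ) ≤ B * ξ ^ η := by
        calc ((Λ.cylinderRatios L m δ).card : ℝ) ≤ ((L : ℝ) + 1) ^ N := by
              exact_mod_cast Λ.card_cylinderRatios_le L m δ
          _ ≤ B * δ ^ (-η) := hcard L
          _ ≤ B * (ξ ^ (-β)) ^ (-η) := by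
              gcongr ?_ * ?_
              exact Real.rpow_le_rpow_of_nonpos (by positivity) hL2 (by linarith)
          _ ≤ B * ξ ^ η := by
              rw [← Real.rpow_mul hξ0.le]
              gcongr
              nlinarith
      calc _ ≤ B * ξ ^ η * (C₁ * m ^ (1 / 2 - s) * ξ ^ (-σ)) := by gcongr
        _ = _ := by rw [Real.rpow_add hξ0]; ring
    have herr : 2 * Real.pi * b ^ 2 / a ^ 2 * (ξ * δ ^ 2) ≤ C₂ * ξ ^ (-σ + η) := by
      have h1 : δ ≤ ξ ^ (-β) / q := by
        rw [le_div_iff₀ hq0, hδ, ← pow_succ]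
        exact hL1.le
      calc 2 * Real.pi * b ^ 2 / a ^ 2 * (ξ * δ ^ 2)
          ≤ 2 * Real.pi * b ^ 2 / a ^ 2 * (ξ * (ξ ^ (-β) / q) ^ 2) := by gcongr
        _ = C₂ * ξ ^ (-σ) := by
            have : ξ ^ (-σ) = ξ * (ξ ^ (-β)) ^ 2 := by
              rw [← Real.rpow_natCast, ← Real.rpow_mul hξ0.le, ← Real.rpow_one_add' hξ0.le]
              · congr 1
                rw [hβ]; push_cast; ring
              · rw [hβ]; push_cast; linarith
            rw [this, hC₂]
            field_simp
        _ ≤ _ := by gcongr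
    refine (add_le_add hsum (ENNReal.ofReal_le_ofReal herr)).trans ?_
    rw [← ENNReal.ofReal_add (by positivity) (by positivity), ← add_mul]
    exact ENNReal.ofReal_le_ofReal (mul_le_mul_of_nonneg_right
      (le_add_of_nonneg_left (by positivity)) (by positivity))

/-! ### Square integrability of the product -/

/-- Pointwise decay of one transform and energy decay of the other give a square integrable
product. -/
lemma lintegral_mul_normSq_fourierTransform_lt_top (μ ν : Measure ℝ) [IsProbabilityMeasure μ]
    [IsFiniteMeasure ν] {C τ D s : ℝ} (hτ : 0 ≤ τ) (hD : 0 < D) (hτs : 1 < 2 * τ + s)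
    (hμ : ∀ ξ : ℝ, 1 ≤ ξ → ‖fourierTransform μ ξ‖ₑ ≤ ENNReal.ofReal (C * ξ ^ (-τ)))
    (hν : ∀ R : ℝ, 0 < R → gaussEnergy ν R ≤ ENNReal.ofReal (D * R ^ (-s))) :
    ∫⁻ ξ, ‖fourierTransform μ ξ‖ₑ ^ 2 * ‖fourierTransform ν ξ‖ₑ ^ 2 < ∞ := by
  set C' := Real.exp (4 * Real.pi) * (1 + C ^ 2) with hC'
  have hC'0 : 0 < C' := by positivity
  have hpi := Real.pi_pos
  -- Dyadic decomposition with Gaussian cutoffs; `exp (4π)` compensates the cutoff at `|ξ| ≤ 2 * 2 ^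
  -- n`, and `n = 0` absorbs `|ξ| ≤ 1`.
  have hpt : ∀ ξ : ℝ, ‖fourierTransform μ ξ‖ₑ ^ 2 ≤ ∑' n : ℕ,
      ENNReal.ofReal (C' * ((2 : ℝ) ^ n) ^ (-(2 * τ))) *
        ENNReal.ofReal (Real.exp (-Real.pi * ξ ^ 2 / ((2 : ℝ) ^ n) ^ 2)) := by
    intro ξ
    have key : ∃ n : ℕ, |ξ| ≤ 2 * 2 ^ n ∧
        ‖fourierTransform μ ξ‖ ^ 2 ≤ (1 + C ^ 2) * ((2 : ℝ) ^ n) ^ (-(2 * τ)) := by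
      rcases le_total |ξ| 1 with h | h
      · refine ⟨0, by linarith, ?_⟩
        have := norm_fourierTransform_le_one μ ξ
        simp only [pow_zero, Real.one_rpow, mul_one]
        nlinarith [norm_nonneg (fourierTransform μ ξ), sq_nonneg C]
      · obtain ⟨n, hn1, hn2⟩ := exists_nat_pow_near h (one_lt_two)
        refine ⟨n, by rw [← pow_succ']; exact hn2.le, ?_⟩
        have e : ‖fourierTransform μ ξ‖ = ‖fourierTransform μ |ξ|‖ := by
          rcases abs_choice ξ with h | h <;> rw [h]
          rw [norm_fourierTransform_neg]
        have h1 := hμ |ξ| h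
        rw [← ofReal_norm, ← e] at h1
        have h2 : ‖fourierTransform μ ξ‖ ≤ |C| * |ξ| ^ (-τ) := by
          have h3 : C * |ξ| ^ (-τ) ≤ |C| * |ξ| ^ (-τ) := by gcongr; exact le_abs_self C
          exact (ENNReal.ofReal_le_ofReal_iff (by positivity)).1
            (h1.trans (ENNReal.ofReal_le_ofReal h3))
        calc ‖fourierTransform μ ξ‖ ^ 2 ≤ (|C| * |ξ| ^ (-τ)) ^ 2 := by gcongr
          _ = C ^ 2 * |ξ| ^ (-(2 * τ)) := by
              rw [mul_pow, sq_abs, ← Real.rpow_natCast (|ξ| ^ (-τ)), ← Real.rpow_mul (abs_nonneg _)]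
              congr 2
              push_cast
              ring
          _ ≤ (1 + C ^ 2) * ((2 : ℝ) ^ n) ^ (-(2 * τ)) := by
              gcongr ?_ * ?_
              · linarith
              · exact Real.rpow_le_rpow_of_nonpos (by positivity) hn1 (by linarith)
    obtain ⟨n, hn, hb⟩ := key
    refine le_trans ?_ (ENNReal.le_tsum n)
    rw [← ofReal_norm, ← ENNReal.ofReal_pow (norm_nonneg _), ← ENNReal.ofReal_mul (by positivity)]
    refine ENNReal.ofReal_le_ofReal (hb.trans ?_)
    have h1 : ξ ^ 2 / ((2 : ℝ) ^ n) ^ 2 ≤ 4 := by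
      rw [div_le_iff₀ (by positivity), ← sq_abs]
      calc |ξ| ^ 2 ≤ (2 * 2 ^ n) ^ 2 := by gcongr
        _ = _ := by ring
    have h2 : 1 ≤ Real.exp (4 * Real.pi) * Real.exp (-Real.pi * ξ ^ 2 / ((2 : ℝ) ^ n) ^ 2) := by
      rw [← Real.exp_add, Real.one_le_exp_iff, mul_div_assoc]
      nlinarith
    rw [hC']
    calc (1 + C ^ 2) * ((2 : ℝ) ^ n) ^ (-(2 * τ))
        ≤ (Real.exp (4 * Real.pi) * Real.exp (-Real.pi * ξ ^ 2 / ((2 : ℝ) ^ n) ^ 2)) *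
          ((1 + C ^ 2) * ((2 : ℝ) ^ n) ^ (-(2 * τ))) :=
          le_mul_of_one_le_left (by positivity) h2
      _ = _ := by ring
  have hmeas : Measurable fun ξ => ‖fourierTransform ν ξ‖ₑ ^ 2 :=
    (continuous_fourierTransform ν).measurable.enorm.pow_const 2
  have hmeas' : ∀ n : ℕ, Measurable fun ξ => ‖fourierTransform ν ξ‖ₑ ^ 2 *
      ENNReal.ofReal (Real.exp (-Real.pi * ξ ^ 2 / ((2 : ℝ) ^ n) ^ 2)) :=
    fun n => hmeas.mul (by fun_prop)
  set x : ℝ := 2 ^ (1 - 2 * τ - s) with hx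
  have hx0 : 0 < x := by positivity
  have hx1 : x < 1 := Real.rpow_lt_one_of_one_lt_of_neg one_lt_two (by linarith)
  calc ∫⁻ ξ, ‖fourierTransform μ ξ‖ₑ ^ 2 * ‖fourierTransform ν ξ‖ₑ ^ 2
      ≤ ∫⁻ ξ, ∑' n : ℕ, ENNReal.ofReal (C' * ((2 : ℝ) ^ n) ^ (-(2 * τ))) *
        (‖fourierTransform ν ξ‖ₑ ^ 2 *
          ENNReal.ofReal (Real.exp (-Real.pi * ξ ^ 2 / ((2 : ℝ) ^ n) ^ 2))) := by
        refine lintegral_mono fun ξ => ?_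
        refine (mul_le_mul_left (hpt ξ) _).trans ?_
        rw [← ENNReal.tsum_mul_right]
        refine ENNReal.tsum_le_tsum fun n => le_of_eq ?_
        ring
    _ = ∑' n : ℕ, ENNReal.ofReal (C' * ((2 : ℝ) ^ n) ^ (-(2 * τ))) *
        (ENNReal.ofReal (2 ^ n) * gaussEnergy ν (2 ^ n)) := by
        rw [lintegral_tsum fun n => ((hmeas' n).const_mul _).aemeasurable]
        congr 1
        ext n
        rw [lintegral_const_mul _ (hmeas' n),
          lintegral_normSq_fourierTransform_mul_gaussian ν (by positivity)]
    _ ≤ ∑' n : ℕ, ENNReal.ofReal (C' * D * x ^ n) := by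
        refine ENNReal.tsum_le_tsum fun n => ?_
        have h2n : (0 : ℝ) < 2 ^ n := by positivity
        refine (mul_le_mul_right (mul_le_mul_right (hν _ h2n) _) _).trans ?_
        rw [← ENNReal.ofReal_mul (by positivity), ← ENNReal.ofReal_mul (by positivity)]
        refine ENNReal.ofReal_le_ofReal (le_of_eq ?_)
        have e : x ^ n = ((2 : ℝ) ^ n) ^ (1 - 2 * τ - s) := by
          rw [hx, ← Real.rpow_natCast, ← Real.rpow_natCast, ← Real.rpow_mul (by norm_num),
            ← Real.rpow_mul (by norm_num), mul_comm]
        rw [e, show (1 - 2 * τ - s : ℝ) = 1 + -(2 * τ) + -s by ring, Real.rpow_add h2n,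
          Real.rpow_add h2n, Real.rpow_one]
        ring
    _ < ∞ := by
        rw [← ENNReal.ofReal_tsum_of_nonneg (fun n => by positivity)
          ((summable_geometric_of_lt_one hx0.le hx1).mul_left _)]
        exact ENNReal.ofReal_lt_top

/-! ### Passing between a measure and its logarithmic image -/

lemma mul_abs_sub_le_abs_log_sub_log {b x y : ℝ} (hx : 0 < x) (hy : 0 < y)
    (hxb : x ≤ b) (hyb : y ≤ b) : b⁻¹ * |x - y| ≤ |Real.log x - Real.log y| := by
  wlog h : y ≤ x generalizing x y
  · rw [abs_sub_comm, abs_sub_comm (Real.log x)]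
    exact this hy hx hyb hxb (le_of_not_ge h)
  have h1 : 1 - (x / y)⁻¹ ≤ Real.log x - Real.log y := by
    rw [← Real.log_div hx.ne' hy.ne']
    exact Real.one_sub_inv_le_log_of_pos (by positivity)
  rw [abs_of_nonneg (sub_nonneg.2 h), abs_of_nonneg (sub_nonneg.2 (Real.log_le_log hy h))]
  refine le_trans ?_ h1
  rw [show 1 - (x / y)⁻¹ = x⁻¹ * (x - y) by field_simp]
  have := sub_nonneg.2 h
  gcongr

lemma mul_abs_sub_le_abs_exp_sub_exp {c u v : ℝ} (hu : c ≤ u) (hv : c ≤ v) :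
    Real.exp c * |u - v| ≤ |Real.exp u - Real.exp v| := by
  wlog h : v ≤ u generalizing u v
  · rw [abs_sub_comm, abs_sub_comm (Real.exp u)]
    exact this hv hu (le_of_not_ge h)
  rw [abs_of_nonneg (sub_nonneg.2 h), abs_of_nonneg (sub_nonneg.2 (Real.exp_le_exp.2 h))]
  have h1 : Real.exp u - Real.exp v = Real.exp v * (Real.exp (u - v) - 1) := by
    rw [mul_sub, ← Real.exp_add]
    simp
  rw [h1]
  exact mul_le_mul (Real.exp_le_exp.2 hv) (by linarith [Real.add_one_le_exp (u - v)])
    (sub_nonneg.2 h) (Real.exp_pos v).le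

/-- Fatou's lemma as the Gaussian weights tend to `1`. -/
lemma lintegral_normSq_fourierTransform_le_of_gaussEnergy (μ : Measure ℝ) [IsFiniteMeasure μ]
    {A : ℝ≥0∞} (h : ∀ R : ℝ, 0 < R → ENNReal.ofReal R * gaussEnergy μ R ≤ A) :
    ∫⁻ ξ, ‖fourierTransform μ ξ‖ₑ ^ 2 ≤ A := by
  have hmeas : Measurable fun ξ => ‖fourierTransform μ ξ‖ₑ ^ 2 :=
    (continuous_fourierTransform μ).measurable.enorm.pow_const 2
  have hlim : ∀ ξ : ℝ, Filter.Tendsto (fun n : ℕ => ‖fourierTransform μ ξ‖ₑ ^ 2 *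
      ENNReal.ofReal (Real.exp (-Real.pi * ξ ^ 2 / ((n : ℝ) + 1) ^ 2))) Filter.atTop
      (𝓝 (‖fourierTransform μ ξ‖ₑ ^ 2)) := by
    intro ξ
    have h1 : Filter.Tendsto (fun n : ℕ => -Real.pi * ξ ^ 2 * (1 / ((n : ℝ) + 1)) ^ 2) Filter.atTop
        (𝓝 (-Real.pi * ξ ^ 2 * 0 ^ 2)) :=
      (tendsto_one_div_add_atTop_nhds_zero_nat.pow 2).const_mul _
    have h2 := ENNReal.tendsto_ofReal ((Real.continuous_exp.tendsto _).comp h1)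
    have h3 := ENNReal.Tendsto.const_mul (a := ‖fourierTransform μ ξ‖ₑ ^ 2) h2
      (.inr (by finiteness))
    simp only [Function.comp_def] at h3
    convert h3 using 2
    · congr 3
      rw [div_pow, one_pow, ← div_eq_mul_one_div]
    · simp
  calc ∫⁻ ξ, ‖fourierTransform μ ξ‖ₑ ^ 2
      = ∫⁻ ξ, Filter.liminf (fun n : ℕ => ‖fourierTransform μ ξ‖ₑ ^ 2 *
        ENNReal.ofReal (Real.exp (-Real.pi * ξ ^ 2 / ((n : ℝ) + 1) ^ 2))) Filter.atTop := by
        congr 1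
        ext ξ
        exact (hlim ξ).liminf_eq.symm
    _ ≤ Filter.liminf (fun n : ℕ => ∫⁻ ξ, ‖fourierTransform μ ξ‖ₑ ^ 2 *
        ENNReal.ofReal (Real.exp (-Real.pi * ξ ^ 2 / ((n : ℝ) + 1) ^ 2))) Filter.atTop :=
        lintegral_liminf_le fun n => hmeas.mul (by fun_prop)
    _ ≤ A := by
        refine Filter.liminf_le_of_frequently_le' (Filter.Frequently.of_forall fun n => ?_)
        rw [lintegral_normSq_fourierTransform_mul_gaussian μ (by positivity)]
        exact h _ (by positivity)

lemma ofReal_mul_gaussEnergy_le (μ : Measure ℝ) [IsFiniteMeasure μ] {R : ℝ} (hR : 0 < R) :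
    ENNReal.ofReal R * gaussEnergy μ R ≤ ∫⁻ ξ, ‖fourierTransform μ ξ‖ₑ ^ 2 := by
  rw [← lintegral_normSq_fourierTransform_mul_gaussian μ hR]
  refine lintegral_mono fun ξ => mul_le_of_le_one_right' ?_
  rw [ENNReal.ofReal_le_one, Real.exp_le_one_iff, neg_mul, neg_div]
  have := Real.pi_pos
  exact neg_nonpos_of_nonneg (by positivity)

/-- A measure on a compact subset of the half line has an `L²` density if its logarithmic image has
a square integrable Fourier transform. -/
lemma hasL2Density_of_map_log (μ : Measure ℝ) [IsFiniteMeasure μ] {a : ℝ} (ha : 0 < a)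
    (hsupp : ∀ᵐ x ∂μ, a ≤ x)
    (h : ∫⁻ ξ, ‖fourierTransform (μ.map Real.log) ξ‖ₑ ^ 2 < ∞) : HasL2Density μ := by
  have hmap : (μ.map Real.log).map Real.exp = μ := by
    rw [Measure.map_map Real.measurable_exp Real.measurable_log]
    conv_rhs => rw [← Measure.map_id (μ := μ)]
    refine Measure.map_congr ?_
    filter_upwards [hsupp] with x hx
    exact Real.exp_log (ha.trans_le hx)
  have hlog : ∀ᵐ u ∂(μ.map Real.log), u ∈ Set.Ici (Real.log a) := by
    refine (ae_map_iff Real.measurable_log.aemeasurable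
      (p := fun u => u ∈ Set.Ici (Real.log a)) measurableSet_Ici).2 ?_
    filter_upwards [hsupp] with x hx
    exact Real.log_le_log ha hx
  refine hasL2Density_of_lintegral_normSq_fourierTransform μ
    ((lintegral_normSq_fourierTransform_le_of_gaussEnergy μ (A := ENNReal.ofReal a⁻¹ *
      ∫⁻ ξ, ‖fourierTransform (μ.map Real.log) ξ‖ₑ ^ 2) fun R hR => ?_).trans_lt
      (ENNReal.mul_lt_top ENNReal.ofReal_lt_top h))
  -- On `[log a, ∞)` the exponential has slope at least `a`.
  have h1 : gaussEnergy μ R ≤ gaussEnergy (μ.map Real.log) (a * R) := by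
    conv_lhs => rw [← hmap]
    refine gaussEnergy_map_le Real.measurable_exp ha.le hlog (fun u hu v hv => ?_) R
    have := mul_abs_sub_le_abs_exp_sub_exp hu hv
    rwa [Real.exp_log ha] at this
  calc ENNReal.ofReal R * gaussEnergy μ R
      ≤ ENNReal.ofReal R * gaussEnergy (μ.map Real.log) (a * R) := by gcongr
    _ = ENNReal.ofReal a⁻¹ * (ENNReal.ofReal (a * R) * gaussEnergy (μ.map Real.log) (a * R)) := by
        rw [← mul_assoc, ← ENNReal.ofReal_mul (by positivity), inv_mul_cancel_left₀ ha.ne']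
    _ ≤ _ := by
        gcongr
        exact ofReal_mul_gaussEnergy_le _ (by positivity)

lemma fourierTransform_map_log_mconv {μ ν : Measure ℝ} [IsFiniteMeasure μ] [IsFiniteMeasure ν]
    (hμ : ∀ᵐ x ∂μ, 0 < x) (hν : ∀ᵐ y ∂ν, 0 < y) (ξ : ℝ) :
    fourierTransform ((Measure.mconv μ ν).map Real.log) ξ =
      fourierTransform (μ.map Real.log) ξ * fourierTransform (ν.map Real.log) ξ := by
  rw [fourierTransform_map_log, fourierTransform_map_log, fourierTransform_map_log,
    Measure.mconv, integral_map (by fun_prop) (Measurable.aestronglyMeasurable (by fun_prop)),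
    ← integral_prod_mul]
  refine integral_congr_ae ?_
  filter_upwards [Measure.quasiMeasurePreserving_fst.ae hμ,
    Measure.quasiMeasurePreserving_snd.ae hν] with z hz1 hz2
  rw [← Complex.exp_add, Real.log_mul hz1.ne' hz2.ne']
  congr 1
  push_cast
  ring

/-! ### Conclusion: the numerical conditions -/

lemma ae_mem_Icc_of_isSelfSimilarMeasure {μ : Measure ℝ} (hμ : IsSelfSimilarMeasure μ)
    (hsupp : μ.support ⊆ Set.Ioi 0) :
    ∃ a b : ℝ, 0 < a ∧ a ≤ b ∧ ∀ᵐ x ∂μ, x ∈ Set.Icc a b := by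
  obtain ⟨hprob, N, Λ, p, K, -, -, hK, hKμ, -⟩ := hμ
  have hsub : μ.support ⊆ K :=
    Measure.support_subset_of_isClosed hK.isCompact.isClosed (mem_ae_iff.2 hKμ)
  have hcomp : IsCompact μ.support := hK.isCompact.of_isClosed_subset Measure.isClosed_support hsub
  have hne : μ.support.Nonempty := Measure.nonempty_support (IsProbabilityMeasure.ne_zero μ)
  obtain ⟨a, ha, ha'⟩ := hcomp.exists_isLeast hne
  obtain ⟨b, hb, hb'⟩ := hcomp.exists_isGreatest hne
  refine ⟨a, b, hsupp ha, ha' hb, ?_⟩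
  filter_upwards [Measure.support_mem_ae (μ := μ)] with x hx
  exact ⟨ha' hx, hb' hx⟩

lemma exists_gaussEnergy_le_of_lt_kappaTwo (μ : Measure ℝ) [IsProbabilityMeasure μ] {t : ℝ}
    (ht : t < kappaTwo μ) : ∃ s D : ℝ, t < s ∧ s < 1 ∧ 0 < D ∧
      ∀ R : ℝ, 0 < R → gaussEnergy μ R ≤ ENNReal.ofReal (D * R ^ (-s)) := by
  have hne : ({s : ℝ | 0 ≤ s ∧ s < 1 ∧ ∃ C : ℝ, ∀ R : ℝ, 0 < R →
      ∫ ξ in Metric.ball (0 : ℝ) R, ‖fourierTransform μ ξ‖ ^ 2 ≤ C * R ^ (1 - s)}).Nonempty := by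
    refine ⟨0, le_rfl, one_pos, 2, fun R hR => ?_⟩
    refine (Real.le_norm_self _).trans ((norm_setIntegral_le_of_norm_le_const (C := 1)
      (Real.volume_ball 0 R ▸ ENNReal.ofReal_lt_top) fun ξ _ => ?_).trans ?_)
    · rw [norm_pow, norm_norm]
      exact pow_le_one₀ (norm_nonneg _) (norm_fourierTransform_le_one μ ξ)
    · simp [Measure.real, hR.le]
  obtain ⟨s, ⟨hs0, hs1, C, hC⟩, hts⟩ := exists_lt_of_lt_csSup hne ht
  obtain ⟨D, hD, hE⟩ := exists_gaussEnergy_le_of_integral_le μ hs0 hC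
  exact ⟨s, D, hts, hs1, hD, hE⟩

lemma kappaTwo_le_one (μ : Measure ℝ) : kappaTwo μ ≤ 1 :=
  Real.sSup_le (fun _ hs => hs.2.1.le) zero_le_one

lemma kappaTwo_nonneg (μ : Measure ℝ) : 0 ≤ kappaTwo μ :=
  Real.sSup_nonneg fun _ hs => hs.1

/-- The multiplicative convolution of two self-similar measures has an `L²` density as soon as the
Fourier decay of the logarithmic image of the first compensates the defect of the second. -/
lemma hasL2Density_mconv_of_kappaTwo {μ ν : Measure ℝ} (hμ : IsSelfSimilarMeasure μ)
    (hν : IsSelfSimilarMeasure ν) (hμ_supp : μ.support ⊆ Set.Ioi 0)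
    (hν_supp : ν.support ⊆ Set.Ioi 0)
    (h : (1 - kappaTwo ν) * (3 + 2 * kappaTwo μ) < 2 * (2 * kappaTwo μ - 1)) :
    HasL2Density (Measure.mconv μ ν) := by
  obtain ⟨a, b, ha, hab, hμab⟩ := ae_mem_Icc_of_isSelfSimilarMeasure hμ hμ_supp
  obtain ⟨c, d, hc, hcd, hνcd⟩ := ae_mem_Icc_of_isSelfSimilarMeasure hν hν_supp
  obtain ⟨hμprob, N, Λ, p, K, hp, hp1, -, -, hμeq⟩ := hμ
  have hνprob := hν.1
  have hκμ1 := kappaTwo_le_one μ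
  have hκν1 := kappaTwo_le_one ν
  have hκμ0 := kappaTwo_nonneg μ
  have hκμ : 1 / 2 < kappaTwo μ := by nlinarith
  -- The supremum defining `κ₂` need not be attained; the strict inequality leaves room to replace
  -- both dimensions by smaller exponents.
  obtain ⟨ε, hε, hε1, hε2⟩ : ∃ ε : ℝ, 0 < ε ∧ 1 / 2 < kappaTwo μ - ε ∧
      (1 - (kappaTwo ν - ε)) * (3 + 2 * (kappaTwo μ - ε)) < 2 * (2 * (kappaTwo μ - ε) - 1) := by
    have hcont1 : Filter.Tendsto (fun ε : ℝ => kappaTwo μ - ε) (𝓝[>] 0) (𝓝 (kappaTwo μ - 0)) :=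
      ((continuous_const.sub continuous_id).tendsto 0).mono_left nhdsWithin_le_nhds
    have hcont2 : Filter.Tendsto (fun ε : ℝ => 2 * (2 * (kappaTwo μ - ε) - 1) -
        (1 - (kappaTwo ν - ε)) * (3 + 2 * (kappaTwo μ - ε))) (𝓝[>] 0)
        (𝓝 (2 * (2 * (kappaTwo μ - 0) - 1) -
          (1 - (kappaTwo ν - 0)) * (3 + 2 * (kappaTwo μ - 0)))) :=
      (Continuous.tendsto (by fun_prop) 0).mono_left nhdsWithin_le_nhds
    have e1 := hcont1.eventually (lt_mem_nhds (a := 1 / 2) (by linarith))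
    have e2 := hcont2.eventually (lt_mem_nhds (a := 0) (by simpa using h))
    obtain ⟨ε, ⟨h1, h2⟩, h3⟩ := ((e1.and e2).and self_mem_nhdsWithin).exists
    exact ⟨ε, h3, h1, by linarith⟩
  obtain ⟨s, D, hs, hs1, hD, hE⟩ := exists_gaussEnergy_le_of_lt_kappaTwo μ (sub_lt_self _ hε)
  obtain ⟨s', D', hs', hs1', hD', hE'⟩ := exists_gaussEnergy_le_of_lt_kappaTwo ν (sub_lt_self _ hε)
  have hs3 : 0 < 3 + 2 * s := by linarith
  set σ := (2 * s - 1) / (3 + 2 * s) with hσ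
  have hσ0 : 0 < σ := div_pos (by linarith) hs3
  have hσs : 1 < 2 * σ + s' := by
    have hν0 : 0 < kappaTwo ν - ε := by nlinarith
    have h0 : (1 - s') * (3 + 2 * s) ≤ (1 - (kappaTwo ν - ε)) * (3 + 2 * s) := by gcongr
    have h1 : (1 - s') * (3 + 2 * s) < 2 * (2 * s - 1) := by
      nlinarith [mul_pos hν0 (sub_pos.2 hs)]
    have h2 : 1 - s' < 2 * (2 * s - 1) / (3 + 2 * s) := by rwa [lt_div_iff₀ hs3]
    rw [mul_div_assoc] at h2
    linarith
  obtain ⟨η, hη0, hη1, hη2⟩ : ∃ η : ℝ, 0 < η ∧ η ≤ σ ∧ 1 < 2 * (σ - η) + s' := by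
    refine ⟨min σ ((2 * σ + s' - 1) / 4), lt_min hσ0 (by linarith), min_le_left _ _, ?_⟩
    have := min_le_right σ ((2 * σ + s' - 1) / 4)
    linarith
  obtain ⟨C, hC, hdecay⟩ := exists_fourierTransform_map_log_le (fun i => (hp i).1) hp1 hμeq ha hab
    hD hμab (by linarith) hE hη0
  have hEν : ∀ R : ℝ, 0 < R →
      gaussEnergy (ν.map Real.log) R ≤ ENNReal.ofReal (D' * d⁻¹ ^ (-s') * R ^ (-s')) := by
    intro R hR
    have hd : 0 < d := hc.trans_le hcd
    refine (gaussEnergy_map_le Real.measurable_log (inv_nonneg.2 hd.le) hνcd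
      (fun x hx y hy => mul_abs_sub_le_abs_log_sub_log (hc.trans_le hx.1) (hc.trans_le hy.1)
        hx.2 hy.2) R).trans ?_
    refine (hE' _ (by positivity)).trans (le_of_eq ?_)
    rw [Real.mul_rpow (by positivity) hR.le, mul_assoc]
  have := Measure.isProbabilityMeasure_map (μ := μ) Real.measurable_log.aemeasurable
  have hd : 0 < d := hc.trans_le hcd
  have hfin := lintegral_mul_normSq_fourierTransform_lt_top (μ.map Real.log) (ν.map Real.log)
    (C := C) (τ := σ - η) (by linarith) (by positivity) hη2 (fun ξ hξ => by
      rw [neg_sub, sub_eq_neg_add]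
      exact hdecay ξ hξ) hEν
  refine hasL2Density_of_map_log _ (mul_pos ha hc) ?_ ?_
  · rw [Measure.mconv, ae_map_iff (by fun_prop) measurableSet_Ici]
    filter_upwards [Measure.quasiMeasurePreserving_fst.ae hμab,
      Measure.quasiMeasurePreserving_snd.ae hνcd] with z hz1 hz2
    exact mul_le_mul hz1.1 hz2.1 hc.le (ha.le.trans hz1.1)
  · simp_rw [fourierTransform_map_log_mconv (hμab.mono fun x hx => ha.trans_le hx.1)
      (hνcd.mono fun x hx => hc.trans_le hx.1), enorm_mul, mul_pow]
    exact hfin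

end

theorem proposition4 (μ ν : Measure ℝ)
    (hμ : IsSelfSimilarMeasure μ) (hν : IsSelfSimilarMeasure ν)
    (hμ_supp : μ.support ⊆ Set.Ioi 0) (hν_supp : ν.support ⊆ Set.Ioi 0)
    (h : min (kappaTwo μ) (kappaTwo ν) > 7 / 9 ∨
      max (4 * kappaTwo μ + 5 * kappaTwo ν) (5 * kappaTwo μ + 4 * kappaTwo ν) > 7 ∨
      (IsADRegular ν ∧
        2 * kappaTwo μ * kappaTwo ν + 3 * kappaTwo μ + 2 * kappaTwo ν > 5)) :
    HasL2Density (Measure.mconv μ ν) := by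
  have hμprob := hμ.1
  have hνprob := hν.1
  have hμ1 := kappaTwo_le_one μ
  have hν1 := kappaTwo_le_one ν
  -- Expanded, these read `2κ₂(μ)κ₂(ν) + 2κ₂(μ) + 3κ₂(ν) > 5` and its mirror image, which is the
  -- third condition's inequality. The second condition reduces to them through `(1 - κ₂(μ))(1 -
  -- κ₂(ν)) ≥ 0`; in the first, the left side exceeds `413/81 > 5`.
  have key : (1 - kappaTwo ν) * (3 + 2 * kappaTwo μ) < 2 * (2 * kappaTwo μ - 1) ∨
      (1 - kappaTwo μ) * (3 + 2 * kappaTwo ν) < 2 * (2 * kappaTwo ν - 1) := by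
    rcases h with h | h | ⟨-, h⟩
    · obtain ⟨h1, h2⟩ := lt_min_iff.1 h
      left
      nlinarith
    · rcases lt_max_iff.1 h with h | h
      · left
        nlinarith
      · right
        nlinarith
    · right
      nlinarith
  rcases key with key | key
  · exact hasL2Density_mconv_of_kappaTwo hμ hν hμ_supp hν_supp key
  · rw [Measure.mconv_comm]
    exact hasL2Density_mconv_of_kappaTwo hν hμ hν_supp hμ_supp key
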